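/- **Setting.** Let $C:\mathbb{R}^n\times\mathbb{R}^m\to\mathbb{R}^n$ be measurable, let $\xi$ be a random vector in $\mathbb{R}^m$ with distribution $\mathbb{P}$, and let $\alpha\in(0,1]$. Put $$F_i(h):=\operatorname{CVaR}_\alpha[C_i(h,\xi)]=\inf_{\eta\in\mathbb{R}}\big\{\eta+\alpha^{-1}\mathbb{E}[C_i(h,\xi)-\eta]^+\big\},\qquad i=1,\dots,n,$$ assumed to be well defined and finite for all $h$ and $i$, where $[x]^+=\max(x,0)$ (componentwise for vectors). Assume that $F=(F_1,\dots,F_n)$ is continuous and strictly monotone on $\mathbb{R}^n$, i.e. $(F(x)-F(y))^\top(x-y)>0$ for all $x\ne y$. Let $A\in\mathbb{R}^{l\times n}$, $b\in\mathbb{R}^l$, let $q=(q^1,\dots,q^s):\mathbb{R}^n\to\mathbb{R}^s$ have affine components, with (constant) Jacobian $Dq$, and assume that $\mathcal{H}=\{h\in\mathbb{R}^n: Ah=b,\ q(h)\le 0\}$ is compact. Let $h^*\in\operatorname{SOL}(\mathcal{H},F)$, i.e. $h^*\in\mathcal{H}$ and $(h-h^*)^\top F(h^*)\ge 0$ for all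 $h\in\mathcal{H}$. Assume the LICQ at $h^*$: the gradients $\nabla q^i(h^*)$ with $q^i(h^*)=0$ together with the rows of $A$ are linearly independent. Let $(h^*,\lambda^*,\mu^*)$ be a KKT point: $F(h^*)+Dq^\top\lambda^*+A^\top\mu^*=0$, $Ah^*=b$, $q(h^*)\le 0$, $\lambda^*\ge 0$, $\lambda^{*\top}q(h^*)=0$. **Algorithm.** Let $u_1,\dots,u_n$ be an orthonormal basis of $\mathbb{R}^n$ whose first $M$ vectors span the row space of $A$, and let $L=I-\sum_{i=1}^M u_iu_i^\top$. Let $(\xi^k_j)_{k\ge 0,\,j\ge 1}$ be i.i.d. samples of $\xi$, let $(\gamma^k)_{k\ge0}$ be positive step sizes with $\sum_k\gamma^k=\infty$ and $\sum_k(\gamma^k)^2<\infty$, let $(N_k)_{k\ge0}$ be natural numbers, and let $h^0\in\mathbb{R}^n$ with $Ah^0=b$ and $\lambda^0\in\mathbb{R}^s_{\ge 0}$. For $k\ge 0$ put $$h^{k+1}=h^k-\gamma^kL\big(F(h^k)+Dq^\top\lambda^k+\widehat\beta^{N_k}\big),\qquad \lambda^{k+1}=\big[\lambda^k+\gamma^kq(h^k)\big]^+,$$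 where $\widehat\beta^{N_k}=\widehat F^{N_k}(h^k)-F(h^k)$ is the error of the empirical estimate $$\widehat F^{N_k}_i(h^k)=\inf_{\eta\in\mathbb{R}}\Big\{\eta+(N_k\alpha)^{-1}\sum_{j=1}^{N_k}\big[C_i(h^k,\xi^k_j)-\eta\big]^+\Big\}.$$ **Claim.** For every $\epsilon>0$ and every $B\in\mathbb{R}$ there is $N_\epsilon\in\mathbb{N}$, depending only on $\epsilon$, $B$ and the data $C,\mathbb{P},\alpha,A,b,q$ (not on the step sizes, the initial values, the samples or $(N_k)$), with the following property. If, with probability one, $\|h^k\|\le B$, $\|\lambda^k\|\le B$ and $\|\widehat\beta^{N_k}\|\le B$ for all $k$, and if $N_k\ge N_\epsilon$ for all $k$, then, with probability one, $$\limsup_{k\to\infty}\|h^k-h^*\|\le\epsilon .$$ -/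

import Mathlib

open Set Filter Topology MeasureTheory ProbabilityTheory
open scoped Matrix

noncomputable section

namespace CVaRVI

/-- `ℝⁿ` with the Euclidean norm and inner product. -/
abbrev Vec (n : ℕ) : Type := EuclideanSpace ℝ (Fin n)

/-! ### Conditional value-at-risk and its empirical estimate -/

/-- `η + α⁻¹ 𝔼[Z - η]⁺`. -/
def cvarObjective {X : Type*} [MeasurableSpace X] (α : ℝ) (P : Measure X) (Z : X → ℝ)
    (η : ℝ) : ℝ :=
  η + α⁻¹ * ∫ x, max (Z x - η) 0 ∂P

/-- `CVaR_α[Z] = inf_η { η + α⁻¹ 𝔼[Z - η]⁺ }`. -/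
def CVaR {X : Type*} [MeasurableSpace X] (α : ℝ) (P : Measure X) (Z : X → ℝ) : ℝ :=
  ⨅ η : ℝ, cvarObjective α P Z η

/-- The CVaR of `Z` is a real number: the expectations in its definition are finite and the
infimum is not `-∞`. -/
def HasFiniteCVaR {X : Type*} [MeasurableSpace X] (α : ℝ) (P : Measure X) (Z : X → ℝ) : Prop :=
  (∀ η : ℝ, Integrable (fun x => max (Z x - η) 0) P) ∧
    BddBelow (range (cvarObjective α P Z))

/-- The empirical CVaR `inf_η { η + (N α)⁻¹ ∑_{j < N} [z j - η]⁺ }` of the samples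
`z 0, …, z (N - 1)`. -/
def empCVaR (α : ℝ) (N : ℕ) (z : ℕ → ℝ) : ℝ :=
  ⨅ η : ℝ, (η + ((N : ℝ) * α)⁻¹ * ∑ j ∈ Finset.range N, max (z j - η) 0)

/-- `F(h) = (CVaR_α[C_i(h, ξ)])_i`, where `ξ` has distribution `P`. -/
def cvarMap {n m : ℕ} (α : ℝ) (P : Measure (Vec m)) (C : Vec n → Vec m → Vec n)
    (h : Vec n) : Vec n :=
  WithLp.toLp 2 fun i => CVaR α P fun x => C h x i

/-- The estimator of `F(h)` from the samples `x 0, …, x (N - 1)` of `ξ`; all components use the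
same samples. -/
def empMap {n m : ℕ} (α : ℝ) (C : Vec n → Vec m → Vec n) (N : ℕ) (x : ℕ → Vec m)
    (h : Vec n) : Vec n :=
  WithLp.toLp 2 fun i => empCVaR α N fun j => C h (x j) i

/-- The estimation error: estimator at `h` minus `F(h)`. -/
def estError {n m : ℕ} (α : ℝ) (P : Measure (Vec m)) (C : Vec n → Vec m → Vec n) (N : ℕ)
    (x : ℕ → Vec m) (h : Vec n) : Vec n :=
  empMap α C N x h - cvarMap α P C h

/-! ### Variational inequalities -/

/-- `{h | A h = b, q^i(h) ≤ 0 for all i}`. -/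
def feasibleSet {n l s : ℕ} (A : Matrix (Fin l) (Fin n) ℝ) (b : Fin l → ℝ)
    (q : Fin s → Vec n → ℝ) : Set (Vec n) :=
  {h | A *ᵥ h.ofLp = b ∧ ∀ i, q i h ≤ 0}

/-- The solution set of `VI(H, F)`. -/
def SOL {n : ℕ} (H : Set (Vec n)) (F : Vec n → Vec n) : Set (Vec n) :=
  {h | h ∈ H ∧ ∀ y ∈ H, 0 ≤ inner ℝ (y - h) (F h)}

/-- Strict monotonicity of a map. -/
def IsStrictlyMonotone {n : ℕ} (F : Vec n → Vec n) : Prop :=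
  ∀ x y : Vec n, x ≠ y → 0 < inner ℝ (F x - F y) (x - y)

/-- The `j`-th row of `A` as a vector of `ℝⁿ`. -/
def rowVec {n l : ℕ} (A : Matrix (Fin l) (Fin n) ℝ) (j : Fin l) : Vec n :=
  WithLp.toLp 2 (A j)

/-- `Dq(h)ᵀ v = ∑ i, v_i ∇q^i(h)`. -/
def jacobianTransposeMul {n s : ℕ} (q : Fin s → Vec n → ℝ) (h : Vec n) (v : Vec s) : Vec n :=
  ∑ i, v i • gradient (q i) h

/-- Linear independence constraint qualification at `h`: the gradients of the active inequality
constraints and the rows of `A` are, together, linearly independent. -/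
def LICQ {n l s : ℕ} (A : Matrix (Fin l) (Fin n) ℝ) (q : Fin s → Vec n → ℝ) (h : Vec n) : Prop :=
  LinearIndependent ℝ
    (Sum.elim (fun i : {i : Fin s // q i h = 0} => gradient (q i) h) (rowVec A))

/-- `(h, lam, mu)` is a KKT point of `VI(H, F)` with `H = feasibleSet A b q`. -/
structure IsKKTPoint {n l s : ℕ} (F : Vec n → Vec n) (A : Matrix (Fin l) (Fin n) ℝ)
    (b : Fin l → ℝ) (q : Fin s → Vec n → ℝ) (h : Vec n) (lam : Vec s) (mu : Vec l) : Prop where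
  stationary : F h + jacobianTransposeMul q h lam + WithLp.toLp 2 (Aᵀ *ᵥ mu.ofLp) = 0
  eq_constraint : A *ᵥ h.ofLp = b
  ineq_constraint : ∀ i, q i h ≤ 0
  multiplier_nonneg : ∀ i, 0 ≤ lam i
  complementarity : ∑ i, lam i * q i h = 0

/-! ### The multiplier-driven algorithm -/

/-- Multiplication by `L = I - ∑_{i < M} u_i u_iᵀ`. -/
def subspaceProj {n : ℕ} (u : OrthonormalBasis (Fin n) ℝ (Vec n)) (M : ℕ) (v : Vec n) : Vec n :=
  v - ∑ i ∈ Finset.univ.filter (fun i : Fin n => i.val < M), inner ℝ (u i) v • u i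

/-- The first `M` vectors of `u` span the row space of `A`. -/
def SpansRows {n l : ℕ} (A : Matrix (Fin l) (Fin n) ℝ) (u : OrthonormalBasis (Fin n) ℝ (Vec n))
    (M : ℕ) : Prop :=
  M ≤ n ∧ Submodule.span ℝ (u '' {i : Fin n | i.val < M}) = Submodule.span ℝ (range (rowVec A))

/-- The iterates `(h^k, λ^k)` of
`h^{k+1} = h^k - γ^k L (F(h^k) + Dq(h^k)ᵀ λ^k + β^k)`, `λ^{k+1} = [λ^k + γ^k q(h^k)]⁺`,
where `β^k` is the error at `h^k` of the estimator of `F` built from the samples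
`x k 0, …, x k (N k - 1)`. -/
def iter {n m s : ℕ} (α : ℝ) (P : Measure (Vec m)) (C : Vec n → Vec m → Vec n)
    (q : Fin s → Vec n → ℝ) (L : Vec n → Vec n) (γ : ℕ → ℝ) (N : ℕ → ℕ)
    (h₀ : Vec n) (lam₀ : Vec s) (x : ℕ → ℕ → Vec m) : ℕ → Vec n × Vec s
  | 0 => (h₀, lam₀)
  | k + 1 =>
    let h := (iter α P C q L γ N h₀ lam₀ x k).1
    let lam := (iter α P C q L γ N h₀ lam₀ x k).2
    (h - γ k • L (cvarMap α P C h + jacobianTransposeMul q h lam + estError α P C (N k) (x k) h),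
      WithLp.toLp 2 fun i => max (lam i + γ k * q i h) 0)

end CVaRVI

end

/-!
Let `d = h - h*` and `ν = λ - λ*`. Without errors, a step of size `γ` decreases `‖d‖² + ‖ν‖²`, up
to `O(γ²)`, by `2γ (⟨F(h) - F(h*), d⟩ - ⟨λ, q(h*)⟩)`. By monotonicity this is nonnegative, but it
also vanishes at points `(h*, λ)` with `λ ≠ λ*` and `λ` supported on the active constraints. There
the cross term `⟨d, Dqᵀ ν⟩` decreases at rate `‖L Dqᵀ ν‖²`, which is positive by the LICQ. By
compactness, `‖d‖² + ‖ν‖² + κ ⟨d, Dqᵀ ν⟩` with a small `κ > 0` therefore decreases at a rate bounded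
below by some `γ θ` on the bounded iterates that are not close to the KKT point.

The errors enter this estimate through `γ ‖β‖`, and it suffices that their conditional means, given
the past, are small: the fluctuations `γ (‖β‖ - 𝔼[‖β‖ | past])` are square-summable martingale
differences, so their sum converges. If all samples exceed a level, so does their empirical CVaR;
hence a bound `B` on the error confines the costs to an interval of length `2B`, whatever the number
`N` of samples. CVaR is `α⁻¹`-Lipschitz in the Wasserstein distance, and the mean distance of the
empirical distribution to the true one is at most `B / √N`.
-/

noncomputable section

namespace CVaRVI

/-! ### Descent of sequences -/

section Descent

variable {γ r t W : ℕ → ℝ} {a c θ η : ℝ}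

theorem frequently_lt_of_descent (hθ : 0 < θ)
    (hγ : Tendsto (fun K => ∑ k ∈ Finset.range K, γ k) atTop atTop)
    (hr : Tendsto (fun K => ∑ k ∈ Finset.range K, r k) atTop (𝓝 a))
    (hdesc : ∀ᶠ k in atTop, c ≤ W k → W (k + 1) ≤ W k - γ k * θ + r k) :
    ∃ᶠ k in atTop, W k < c := by
  intro hlarge
  obtain ⟨k₀, hk₀⟩ := eventually_atTop.1 (hlarge.and hdesc)
  set Φ : ℕ → ℝ := fun K =>
    W K + θ * ∑ k ∈ Finset.range K, γ k - ∑ k ∈ Finset.range K, r k with hΦ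
  have hanti : ∀ k ≥ k₀, Φ k ≤ Φ k₀ := by
    intro k hk
    induction k, hk using Nat.le_induction with
    | base => rfl
    | succ k hk ih =>
      have hstep := (hk₀ k hk).2 (not_lt.1 (hk₀ k hk).1)
      simp only [hΦ, Finset.sum_range_succ] at ih ⊢
      linarith
  have hgrow : Tendsto (fun K => c + (θ * ∑ k ∈ Finset.range K, γ k + -∑ k ∈ Finset.range K, r k))
      atTop atTop :=
    tendsto_atTop_add_const_left _ c ((hγ.const_mul_atTop hθ).atTop_add hr.neg)
  obtain ⟨k, hk, hkΦ⟩ := ((eventually_ge_atTop k₀).and (hgrow.eventually_gt_atTop (Φ k₀))).exists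
  have hWk := not_lt.1 (hk₀ k hk).1
  have := hanti k hk
  simp only [hΦ] at this hkΦ
  linarith

theorem eventually_le_of_frequently_lt (hη : 0 < η)
    (hr : Tendsto (fun K => ∑ k ∈ Finset.range K, r k) atTop (𝓝 a)) (ht : Tendsto t atTop (𝓝 0))
    (hstep : ∀ᶠ k in atTop, W (k + 1) ≤ W k + t k)
    (hdesc : ∀ᶠ k in atTop, c ≤ W k → W (k + 1) ≤ W k + r k) (hfreq : ∃ᶠ k in atTop, W k < c) :
    ∀ᶠ k in atTop, W k ≤ c + η := by
  set S : ℕ → ℝ := fun K => ∑ k ∈ Finset.range K, r k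
  have hSa : ∀ᶠ k in atTop, |S k - a| < η / 4 :=
    hr.eventually (Metric.ball_mem_nhds a (by positivity))
  have ht' : ∀ᶠ k in atTop, t k < η / 2 := ht.eventually_lt_const (by positivity)
  obtain ⟨k₀, hk₀⟩ := eventually_atTop.1 (hSa.and (ht'.and (hstep.and hdesc)))
  obtain ⟨k₁, hk₁, hWk₁⟩ := frequently_atTop.1 hfreq k₀
  -- `j` is the time of the last visit below the level `c`, or the step after it
  have hexcursion : ∀ k ≥ k₁, ∃ j ≥ k₀, W k ≤ c + η / 2 + (S k - S j) := by
    intro k hk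
    induction k, hk using Nat.le_induction with
    | base => exact ⟨k₁, hk₁, by linarith⟩
    | succ k hk ih =>
      obtain ⟨-, htk, hstepk, hdesck⟩ := hk₀ k (hk₁.trans hk)
      obtain hc | hc := le_or_gt c (W k)
      · obtain ⟨j, hj, hWj⟩ := ih
        have hSk : S (k + 1) = S k + r k := Finset.sum_range_succ _ _
        exact ⟨j, hj, by linarith [hdesck hc]⟩
      · exact ⟨k + 1, by lia, by linarith⟩
  filter_upwards [eventually_ge_atTop k₁] with k hk
  obtain ⟨j, hj, hWj⟩ := hexcursion k hk
  linarith [abs_lt.1 (hk₀ k (hk₁.trans hk)).1, abs_lt.1 (hk₀ j hj).1]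

theorem eventually_le_of_descent (hθ : 0 < θ) (hη : 0 < η) (hγ₀ : ∀ k, 0 ≤ γ k)
    (hγ : Tendsto (fun K => ∑ k ∈ Finset.range K, γ k) atTop atTop)
    (hr : Tendsto (fun K => ∑ k ∈ Finset.range K, r k) atTop (𝓝 a)) (ht : Tendsto t atTop (𝓝 0))
    (hstep : ∀ᶠ k in atTop, W (k + 1) ≤ W k + t k)
    (hdesc : ∀ᶠ k in atTop, c ≤ W k → W (k + 1) ≤ W k - γ k * θ + r k) :
    ∀ᶠ k in atTop, W k ≤ c + η :=
  eventually_le_of_frequently_lt hη hr ht hstep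
    (hdesc.mono fun k hk hc => (hk hc).trans <| by linarith [mul_nonneg (hγ₀ k) hθ.le])
    (frequently_lt_of_descent hθ hγ hr hdesc)

end Descent

section Compactness

variable {X : Type*} [TopologicalSpace X]

theorem exists_pos_forall_le_add_mul {Z : Set X} (hZ : IsCompact Z) {f g : X → ℝ}
    (hf : ContinuousOn f Z) (hg : ContinuousOn g Z) (hf₀ : ∀ x ∈ Z, 0 ≤ f x)
    (hfg : ∀ x ∈ Z, f x = 0 → 0 < g x) :
    ∃ κ₀ > 0, ∀ κ, 0 < κ → κ ≤ κ₀ → ∃ θ > 0, ∀ x ∈ Z, θ ≤ f x + κ * g x := by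
  obtain ⟨M, hM⟩ := hZ.exists_bound_of_continuousOn hg
  have hZg : IsCompact (Z ∩ g ⁻¹' Iic 0) := by
    obtain ⟨T, hT, hTeq⟩ := (continuousOn_iff_isClosed.1 hg) _ isClosed_Iic
    rw [inter_comm, hTeq, inter_comm]
    exact hZ.inter_right hT
  obtain ⟨m, hm, hmf⟩ : ∃ m > 0, ∀ x ∈ Z ∩ g ⁻¹' Iic 0, m ≤ f x :=
    hZg.exists_forall_le' (hf.mono inter_subset_left) fun x hx =>
      (hf₀ x hx.1).lt_of_ne' fun h0 => (hfg x hx.1 h0).not_ge hx.2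
  refine ⟨m / (|M| + 1), by positivity, fun κ hκ hκ₀ => ?_⟩
  refine hZ.exists_forall_le' (hf.fun_add (hg.const_mul κ)) fun x hx => ?_
  obtain hgx | hgx := le_or_gt (g x) 0
  · have hbound : κ * -g x ≤ κ * |M| := by
      gcongr
      exact (neg_le_abs _).trans ((hM x hx).trans (le_abs_self M))
    have hκM : κ * (|M| + 1) ≤ m := (le_div_iff₀ (by positivity)).1 hκ₀
    linarith [hmf x ⟨hx, hgx⟩]
  · linarith [hf₀ x hx, mul_pos hκ hgx]

end Compactness

/-! ### The primal-dual iteration with deterministic errors -/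

section PrimalDual

variable {E ι : Type*} [NormedAddCommGroup E] [InnerProductSpace ℝ E]

/-- The projection `[v]⁺` of `v` onto the nonnegative orthant. -/
def nonnegPart (v : EuclideanSpace ℝ ι) : EuclideanSpace ℝ ι :=
  WithLp.toLp 2 fun i => max (v i) 0

theorem nonnegPart_nonneg (v : EuclideanSpace ℝ ι) (i : ι) : 0 ≤ nonnegPart v i :=
  le_max_right _ _

/-- One step of the projected primal-dual iteration on `x = (h, λ)` with operator `F`, constraint
map `q`, transposed Jacobian `G` of `q`, step size `γ` and error `β`; the directions of motion of
`h` are confined to the subspace `U`. -/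
def primalDualStep (U : Submodule ℝ E) [U.HasOrthogonalProjection] (F : E → E)
    (G : EuclideanSpace ℝ ι →L[ℝ] E) (q : E → EuclideanSpace ℝ ι) (γ : ℝ) (β : E)
    (x : E × EuclideanSpace ℝ ι) : E × EuclideanSpace ℝ ι :=
  (x.1 - γ • U.starProjection (F x.1 + G x.2 + β), nonnegPart (x.2 + γ • q x.1))

variable {U : Submodule ℝ E} [U.HasOrthogonalProjection] {F : E → E}
  {G : EuclideanSpace ℝ ι →L[ℝ] E} {q : E → EuclideanSpace ℝ ι} {γ κ B : ℝ} {β : E}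
  {x z : E × EuclideanSpace ℝ ι}

theorem primalDualStep_fst_sub_mem (hx : x.1 - z.1 ∈ U) :
    (primalDualStep U F G q γ β x).1 - z.1 ∈ U := by
  rw [primalDualStep, sub_right_comm]
  exact U.sub_mem hx (U.smul_mem _ (Submodule.starProjection_apply_mem _ _))

theorem continuous_primalDualStep (hF : Continuous F) (hq : Continuous q) :
    Continuous fun p : E × (E × EuclideanSpace ℝ ι) => primalDualStep U F G q γ p.1 p.2 := by
  have hdual : Continuous fun p : E × (E × EuclideanSpace ℝ ι) =>
      nonnegPart (p.2.2 + γ • q p.2.1) := by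
    refine (PiLp.continuous_toLp 2 _).comp (continuous_pi fun i => ?_)
    simp only [PiLp.add_apply, PiLp.smul_apply]
    fun_prop
  unfold primalDualStep
  fun_prop

/-- The KKT conditions at `z = (h, λ)`, with the multiplier of the equality constraints eliminated
by projecting the stationarity equation to the subspace `U` of feasible directions. -/
structure IsProjectedKKT (U : Submodule ℝ E) [U.HasOrthogonalProjection] (F : E → E)
    (G : EuclideanSpace ℝ ι →L[ℝ] E) (q : E → EuclideanSpace ℝ ι)
    (z : E × EuclideanSpace ℝ ι) : Prop where
  stationary : U.starProjection (F z.1 + G z.2) = 0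
  ineq_constraint : ∀ i, q z.1 i ≤ 0
  multiplier_nonneg : ∀ i, 0 ≤ z.2 i
  complementarity : ∀ i, z.2 i * q z.1 i = 0

variable [Fintype ι]

theorem norm_nonnegPart_sub_le {w : EuclideanSpace ℝ ι} (hw : ∀ i, 0 ≤ w i)
    (v : EuclideanSpace ℝ ι) : ‖nonnegPart v - w‖ ≤ ‖v - w‖ := by
  rw [← sq_le_sq₀ (norm_nonneg _) (norm_nonneg _), EuclideanSpace.norm_sq_eq,
    EuclideanSpace.norm_sq_eq]
  refine Finset.sum_le_sum fun i _ => ?_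
  have := abs_max_sub_max_le_abs (v i) (w i) 0
  rw [max_eq_left (hw i)] at this
  exact pow_le_pow_left₀ (norm_nonneg _) this 2

/-- The Lyapunov function of the iteration, evaluated at the deviation `y` from a KKT pair: the
squared norm plus a cross term of weight `κ`, which makes the multipliers contract as well. -/
def lyapunov (G : EuclideanSpace ℝ ι →L[ℝ] E) (κ : ℝ) (y : E × EuclideanSpace ℝ ι) : ℝ :=
  ‖y.1‖ ^ 2 + ‖y.2‖ ^ 2 + κ * inner ℝ y.1 (G y.2)

/-- The rate at which the squared distance to `z` decreases, up to a factor `2`. -/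
def gap (F : E → E) (q : E → EuclideanSpace ℝ ι) (z x : E × EuclideanSpace ℝ ι) : ℝ :=
  inner ℝ (F x.1 - F z.1) (x.1 - z.1) - inner ℝ x.2 (q z.1)

/-- A lower bound for the rate at which the cross term of the Lyapunov function decreases. -/
def crossRate (U : Submodule ℝ E) [U.HasOrthogonalProjection] (F : E → E)
    (G : EuclideanSpace ℝ ι →L[ℝ] E) (q : E → EuclideanSpace ℝ ι)
    (z x : E × EuclideanSpace ℝ ι) : ℝ :=
  inner ℝ (U.starProjection (F x.1 + G x.2)) (G (x.2 - z.2)) - ‖G‖ * ‖x.1 - z.1‖ * ‖q x.1‖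

theorem norm_primalDualStep_snd_sub_sq_le (hz : ∀ i, 0 ≤ z.2 i) :
    ‖(primalDualStep U F G q γ β x).2 - z.2‖ ^ 2 ≤
      ‖x.2 - z.2‖ ^ 2 + 2 * γ * inner ℝ (x.2 - z.2) (q x.1) + γ ^ 2 * ‖q x.1‖ ^ 2 := by
  calc ‖(primalDualStep U F G q γ β x).2 - z.2‖ ^ 2
      ≤ ‖x.2 + γ • q x.1 - z.2‖ ^ 2 := by gcongr; exact norm_nonnegPart_sub_le hz _
    _ = ‖x.2 - z.2‖ ^ 2 + 2 * γ * inner ℝ (x.2 - z.2) (q x.1) + γ ^ 2 * ‖q x.1‖ ^ 2 := by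
        rw [add_sub_right_comm, norm_add_sq_real, inner_smul_right, norm_smul, mul_pow,
          Real.norm_eq_abs, sq_abs]
        ring

theorem norm_primalDualStep_snd_sub_self_le (hγ : 0 ≤ γ) (hx : ∀ i, 0 ≤ x.2 i) :
    ‖(primalDualStep U F G q γ β x).2 - x.2‖ ≤ γ * ‖q x.1‖ := by
  simpa [primalDualStep, norm_smul, abs_of_nonneg hγ] using
    norm_nonnegPart_sub_le hx (x.2 + γ • q x.1)

theorem inner_projected_direction (hz : IsProjectedKKT U F G q z)
    (hadj : ∀ x y v, inner ℝ (q x - q y) v = inner ℝ (x - y) (G v)) (hxU : x.1 - z.1 ∈ U) :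
    inner ℝ (x.1 - z.1) (U.starProjection (F x.1 + G x.2 + β)) =
      gap F q z x + inner ℝ (x.2 - z.2) (q x.1) + inner ℝ (x.1 - z.1) β := by
  have hproj (v : E) : inner ℝ (x.1 - z.1) (U.starProjection v) = inner ℝ (x.1 - z.1) v := by
    rw [← Submodule.inner_starProjection_left_eq_right, Submodule.starProjection_eq_self_iff.2 hxU]
  have hstat : inner ℝ (x.1 - z.1) (F z.1 + G z.2) = 0 := by
    rw [← hproj, hz.stationary, inner_zero_right]
  have hcompl : inner ℝ z.2 (q z.1) = 0 := by
    rw [PiLp.inner_apply]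
    exact Finset.sum_eq_zero fun i _ => by simpa [mul_comm] using hz.complementarity i
  have hadj' := hadj x.1 z.1 (x.2 - z.2)
  rw [hproj, gap]
  simp only [map_sub, inner_sub_left, inner_sub_right, inner_add_right, real_inner_comm] at *
  linarith

theorem dist_sq_primalDualStep_le (hz : IsProjectedKKT U F G q z)
    (hadj : ∀ x y v, inner ℝ (q x - q y) v = inner ℝ (x - y) (G v)) (hγ : 0 ≤ γ)
    (hxU : x.1 - z.1 ∈ U) :
    ‖(primalDualStep U F G q γ β x).1 - z.1‖ ^ 2 + ‖(primalDualStep U F G q γ β x).2 - z.2‖ ^ 2 ≤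
      ‖x.1 - z.1‖ ^ 2 + ‖x.2 - z.2‖ ^ 2 - γ * (2 * gap F q z x) + γ * ‖β‖ * (2 * ‖x.1 - z.1‖)
        + γ ^ 2 * (‖U.starProjection (F x.1 + G x.2 + β)‖ ^ 2 + ‖q x.1‖ ^ 2) := by
  have hprimal : ‖(primalDualStep U F G q γ β x).1 - z.1‖ ^ 2 = ‖x.1 - z.1‖ ^ 2
      - 2 * γ * (gap F q z x + inner ℝ (x.2 - z.2) (q x.1) + inner ℝ (x.1 - z.1) β)
      + γ ^ 2 * ‖U.starProjection (F x.1 + G x.2 + β)‖ ^ 2 := by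
    rw [← inner_projected_direction hz hadj hxU, primalDualStep, sub_right_comm, norm_sub_sq_real,
      inner_smul_right, norm_smul, mul_pow, Real.norm_eq_abs, sq_abs]
    ring
  have hdual := norm_primalDualStep_snd_sub_sq_le (U := U) (F := F) (G := G) (q := q) (γ := γ)
    (β := β) (x := x) hz.multiplier_nonneg
  have herror : -(‖x.1 - z.1‖ * ‖β‖) ≤ inner ℝ (x.1 - z.1) β :=
    (abs_le.1 (abs_real_inner_le_norm _ _)).1
  linarith [mul_le_mul_of_nonneg_left herror hγ]

theorem inner_primalDualStep_le (hγ : 0 ≤ γ) (hx : ∀ i, 0 ≤ x.2 i) :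
    inner ℝ ((primalDualStep U F G q γ β x).1 - z.1) (G ((primalDualStep U F G q γ β x).2 - z.2)) ≤
      inner ℝ (x.1 - z.1) (G (x.2 - z.2)) - γ * crossRate U F G q z x
        + γ * ‖β‖ * ‖G (x.2 - z.2)‖
        + γ ^ 2 * (‖G‖ * ‖U.starProjection (F x.1 + G x.2 + β)‖ * ‖q x.1‖) := by
  set w := U.starProjection (F x.1 + G x.2 + β) with hw
  set y := primalDualStep U F G q γ β x with hy
  have hprimal : y.1 - z.1 = x.1 - z.1 - γ • w := by rw [hy, primalDualStep, sub_right_comm]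
  have hdual : G (y.2 - z.2) = G (x.2 - z.2) + G (y.2 - x.2) := by rw [← map_add]; congr 1; abel
  have herror : -(‖β‖ * ‖G (x.2 - z.2)‖) ≤ inner ℝ (U.starProjection β) (G (x.2 - z.2)) := by
    refine le_trans ?_ (abs_le.1 (abs_real_inner_le_norm _ _)).1
    gcongr
    exact U.norm_starProjection_apply_le β
  have hremainder : inner ℝ (x.1 - z.1 - γ • w) (G (y.2 - x.2)) ≤
      (‖x.1 - z.1‖ + γ * ‖w‖) * (‖G‖ * (γ * ‖q x.1‖)) := by
    refine (real_inner_le_norm _ _).trans ?_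
    gcongr
    · exact (norm_sub_le _ _).trans_eq (by rw [norm_smul, Real.norm_of_nonneg hγ])
    · exact (G.le_opNorm _).trans (by gcongr; exact norm_primalDualStep_snd_sub_self_le hγ hx)
  have hwsplit : inner ℝ w (G (x.2 - z.2)) = inner ℝ (U.starProjection (F x.1 + G x.2))
      (G (x.2 - z.2)) + inner ℝ (U.starProjection β) (G (x.2 - z.2)) := by
    rw [hw, map_add, inner_add_left]
  rw [hprimal, hdual, inner_add_right, inner_sub_left (x.1 - z.1), real_inner_smul_left, hwsplit,
    crossRate]
  linarith [mul_le_mul_of_nonneg_left herror hγ]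

theorem lyapunov_primalDualStep_le (hz : IsProjectedKKT U F G q z)
    (hadj : ∀ x y v, inner ℝ (q x - q y) v = inner ℝ (x - y) (G v)) (hκ : 0 ≤ κ) (hγ : 0 ≤ γ)
    (hxU : x.1 - z.1 ∈ U) (hx : ∀ i, 0 ≤ x.2 i) :
    lyapunov G κ (primalDualStep U F G q γ β x - z) ≤
      lyapunov G κ (x - z) - γ * (2 * gap F q z x + κ * crossRate U F G q z x)
        + γ * ‖β‖ * (2 * ‖x.1 - z.1‖ + κ * ‖G (x.2 - z.2)‖)
        + γ ^ 2 * (‖U.starProjection (F x.1 + G x.2 + β)‖ ^ 2 + ‖q x.1‖ ^ 2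
          + κ * (‖G‖ * ‖U.starProjection (F x.1 + G x.2 + β)‖ * ‖q x.1‖)) := by
  have hdist := dist_sq_primalDualStep_le (β := β) hz hadj hγ hxU
  have hcross := inner_primalDualStep_le (U := U) (F := F) (G := G) (q := q) (β := β) (z := z) hγ hx
  simp only [lyapunov, Prod.fst_sub, Prod.snd_sub]
  linarith [mul_le_mul_of_nonneg_left hcross hκ]

theorem abs_lyapunov_sub_le (hκ : 0 ≤ κ) (hκG : κ * ‖G‖ ≤ 1) (y : E × EuclideanSpace ℝ ι) :
    |lyapunov G κ y - (‖y.1‖ ^ 2 + ‖y.2‖ ^ 2)| ≤ (‖y.1‖ ^ 2 + ‖y.2‖ ^ 2) / 2 := by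
  have hcross : |inner ℝ y.1 (G y.2)| ≤ ‖G‖ * (‖y.1‖ * ‖y.2‖) := by
    refine (abs_real_inner_le_norm _ _).trans ?_
    rw [mul_left_comm]
    gcongr
    exact G.le_opNorm _
  rw [lyapunov, add_sub_cancel_left, abs_mul, abs_of_nonneg hκ]
  calc κ * |inner ℝ y.1 (G y.2)| ≤ κ * (‖G‖ * (‖y.1‖ * ‖y.2‖)) := by gcongr
    _ = κ * ‖G‖ * (‖y.1‖ * ‖y.2‖) := by ring
    _ ≤ 1 * (‖y.1‖ * ‖y.2‖) := by gcongr
    _ ≤ (‖y.1‖ ^ 2 + ‖y.2‖ ^ 2) / 2 := by linarith [two_mul_le_add_sq ‖y.1‖ ‖y.2‖]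

theorem inner_constraint_nonpos (hz : IsProjectedKKT U F G q z) (hx : ∀ i, 0 ≤ x.2 i) :
    inner ℝ x.2 (q z.1) ≤ 0 := by
  rw [PiLp.inner_apply]
  exact Finset.sum_nonpos fun i _ => by
    simpa [mul_comm] using mul_nonpos_of_nonneg_of_nonpos (hx i) (hz.ineq_constraint i)

theorem gap_nonneg (hz : IsProjectedKKT U F G q z)
    (hmono : ∀ h, h ≠ z.1 → 0 < inner ℝ (F h - F z.1) (h - z.1)) (hx : ∀ i, 0 ≤ x.2 i) :
    0 ≤ gap F q z x := by
  have hF : 0 ≤ inner ℝ (F x.1 - F z.1) (x.1 - z.1) := by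
    obtain hxz | hxz := eq_or_ne x.1 z.1
    · simp [hxz]
    · exact (hmono _ hxz).le
  rw [gap]
  linarith [inner_constraint_nonpos hz hx]

theorem eq_of_gap_eq_zero (hz : IsProjectedKKT U F G q z)
    (hmono : ∀ h, h ≠ z.1 → 0 < inner ℝ (F h - F z.1) (h - z.1)) (hx : ∀ i, 0 ≤ x.2 i)
    (hgap : gap F q z x = 0) :
    x.1 = z.1 ∧ ∀ i, q z.1 i ≠ 0 → (x.2 - z.2) i = 0 := by
  have hle := inner_constraint_nonpos hz hx
  have hxz : x.1 = z.1 := by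
    by_contra hne
    rw [gap] at hgap
    linarith [hmono _ hne]
  refine ⟨hxz, fun i hi => ?_⟩
  have hsum : ∑ i, x.2 i * q z.1 i = 0 := by
    simpa [gap, hxz, PiLp.inner_apply, mul_comm] using hgap
  have hterm := (Finset.sum_eq_zero_iff_of_nonpos fun i _ =>
    mul_nonpos_of_nonneg_of_nonpos (hx i) (hz.ineq_constraint i)).1 hsum i (Finset.mem_univ i)
  simp [(mul_eq_zero.1 hterm).resolve_right hi,
    (mul_eq_zero.1 (hz.complementarity i)).resolve_right hi]

theorem crossRate_pos_of_gap_eq_zero (hz : IsProjectedKKT U F G q z)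
    (hmono : ∀ h, h ≠ z.1 → 0 < inner ℝ (F h - F z.1) (h - z.1))
    (hinj : ∀ v, (∀ i, q z.1 i ≠ 0 → v i = 0) → U.starProjection (G v) = 0 → v = 0)
    (hx : ∀ i, 0 ≤ x.2 i) (hne : x ≠ z) (hgap : gap F q z x = 0) :
    0 < crossRate U F G q z x := by
  obtain ⟨hxz, hinactive⟩ := eq_of_gap_eq_zero hz hmono hx hgap
  have hν : U.starProjection (G (x.2 - z.2)) ≠ 0 := fun h0 =>
    hne (Prod.ext hxz (sub_eq_zero.1 (hinj _ hinactive h0)))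
  have hproj : U.starProjection (F x.1 + G x.2) = U.starProjection (G (x.2 - z.2)) := by
    rw [← sub_zero (U.starProjection (F x.1 + G x.2)), ← hz.stationary, ← map_sub, hxz, map_sub G,
      add_sub_add_left_eq_sub]
  rw [crossRate, hproj, hxz, sub_self, norm_zero, mul_zero, zero_mul, sub_zero]
  refine (pow_pos (norm_pos_iff.2 fun h0 => hν ?_) 2).trans_eq
    (U.re_inner_starProjection_eq_normSq (G (x.2 - z.2))).symm
  rw [Submodule.starProjection_apply, h0, Submodule.coe_zero]

theorem continuous_gap (hF : Continuous F) : Continuous (gap F q z) := by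
  unfold gap
  fun_prop

theorem continuous_crossRate (hF : Continuous F) (hq : Continuous q) :
    Continuous (crossRate U F G q z) := by
  unfold crossRate
  fun_prop

section Runs

/-- The Robbins-Monro conditions on a sequence of step sizes. -/
structure IsRobbinsMonro (γ : ℕ → ℝ) : Prop where
  pos : ∀ k, 0 < γ k
  tendsto_sum : Tendsto (fun K => ∑ k ∈ Finset.range K, γ k) atTop atTop
  summable_sq : Summable fun k => γ k ^ 2

/-- A run of the iteration with step sizes `γ` and errors `β`, started with nonnegative multipliers
in `z.1 + U`, along which the iterates and the errors are bounded by `B`. -/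
structure IsBoundedRun (U : Submodule ℝ E) [U.HasOrthogonalProjection] (F : E → E)
    (G : EuclideanSpace ℝ ι →L[ℝ] E) (q : E → EuclideanSpace ℝ ι)
    (z : E × EuclideanSpace ℝ ι) (B : ℝ) (γ : ℕ → ℝ) (β : ℕ → E)
    (x : ℕ → E × EuclideanSpace ℝ ι) : Prop where
  step : ∀ k, x (k + 1) = primalDualStep U F G q (γ k) (β k) (x k)
  start_mem : (x 0).1 - z.1 ∈ U
  start_nonneg : ∀ i, 0 ≤ (x 0).2 i
  norm_fst_le : ∀ k, ‖(x k).1‖ ≤ B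
  norm_snd_le : ∀ k, ‖(x k).2‖ ≤ B
  norm_error_le : ∀ k, ‖β k‖ ≤ B

/-- The region of the points bounded by `B` with nonnegative multipliers whose squared distance to
`z` is at least `δ`. -/
def farRegion (B δ : ℝ) (z : E × EuclideanSpace ℝ ι) : Set (E × EuclideanSpace ℝ ι) :=
  {x | ‖x.1‖ ≤ B ∧ ‖x.2‖ ≤ B ∧ (∀ i, 0 ≤ x.2 i) ∧ δ ≤ ‖x.1 - z.1‖ ^ 2 + ‖x.2 - z.2‖ ^ 2}

variable {γ e : ℕ → ℝ} {β : ℕ → E} {x : ℕ → E × EuclideanSpace ℝ ι} {δ θ K a : ℝ}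

theorem IsRobbinsMonro.tendsto_zero (hγ : IsRobbinsMonro γ) : Tendsto γ atTop (𝓝 0) := by
  simpa [Real.sqrt_sq (hγ.pos _).le] using hγ.summable_sq.tendsto_atTop_zero.sqrt

theorem IsBoundedRun.fst_sub_mem (hx : IsBoundedRun U F G q z B γ β x) (k : ℕ) :
    (x k).1 - z.1 ∈ U := by
  induction k with
  | zero => exact hx.start_mem
  | succ k ih => exact hx.step k ▸ primalDualStep_fst_sub_mem ih

theorem IsBoundedRun.snd_nonneg (hx : IsBoundedRun U F G q z B γ β x) (k : ℕ) (i : ι) :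
    0 ≤ (x k).2 i := by
  cases k with
  | zero => exact hx.start_nonneg i
  | succ k => exact hx.step k ▸ nonnegPart_nonneg _ i

theorem IsBoundedRun.mem_farRegion (hx : IsBoundedRun U F G q z B γ β x) (hκ : 0 ≤ κ)
    (hκG : κ * ‖G‖ ≤ 1) {k : ℕ} (hfar : 2 * δ ≤ lyapunov G κ (x k - z)) :
    x k ∈ farRegion B δ z := by
  have hV := abs_le.1 (abs_lyapunov_sub_le hκ hκG (x k - z))
  have hsq : 0 ≤ ‖(x k).1 - z.1‖ ^ 2 + ‖(x k).2 - z.2‖ ^ 2 := by positivity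
  rw [Prod.fst_sub, Prod.snd_sub] at hV
  exact ⟨hx.norm_fst_le k, hx.norm_snd_le k, hx.snd_nonneg k, by linarith⟩

theorem IsBoundedRun.eventually_lyapunov_le (hx : IsBoundedRun U F G q z B γ β x)
    (hγ : IsRobbinsMonro γ) (hκ : 0 ≤ κ) (hκG : κ * ‖G‖ ≤ 1) (hδ : 0 < δ) (hθ : 0 < θ)
    (hrate : ∀ y ∈ farRegion B δ z, θ ≤ 2 * gap F q z y + κ * crossRate U F G q z y)
    (hrateK : ∀ k, |2 * gap F q z (x k) + κ * crossRate U F G q z (x k)| ≤ K)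
    (hstep : ∀ k, lyapunov G κ (x (k + 1) - z) ≤ lyapunov G κ (x k - z)
      - γ k * (2 * gap F q z (x k) + κ * crossRate U F G q z (x k))
      + K * (γ k * ‖β k‖ + γ k ^ 2))
    (he : ∀ k, K * e k ≤ θ / 2)
    (ha : Tendsto (fun n => ∑ k ∈ Finset.range n, γ k * (‖β k‖ - e k)) atTop (𝓝 a)) :
    ∀ᶠ k in atTop, lyapunov G κ (x k - z) ≤ 4 * δ := by
  rw [show 4 * δ = 2 * δ + 2 * δ by ring]
  have hγ₀ := hγ.tendsto_zero
  have hK : 0 ≤ K := (abs_nonneg _).trans (hrateK 0)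
  refine eventually_le_of_descent (θ := θ / 2) (a := K * a + K * ∑' k, γ k ^ 2)
    (r := fun k => K * (γ k * (‖β k‖ - e k)) + K * γ k ^ 2)
    (t := fun k => K * (γ k + (γ k * B + γ k ^ 2))) (by positivity) (by positivity)
    (fun k => (hγ.pos k).le) hγ.tendsto_sum ?_ ?_ (.of_forall fun k => ?_)
    (.of_forall fun k hfar => ?_)
  · simp only [Finset.sum_add_distrib, ← Finset.mul_sum]
    exact (ha.const_mul K).add (hγ.summable_sq.hasSum.tendsto_sum_nat.const_mul K)
  · simpa using (hγ₀.add ((hγ₀.mul_const B).add (hγ₀.pow 2))).const_mul K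
  · linarith [hstep k, mul_le_mul_of_nonneg_left (neg_le_of_abs_le (hrateK k)) (hγ.pos k).le,
      mul_le_mul_of_nonneg_left (hx.norm_error_le k) (mul_nonneg hK (hγ.pos k).le)]
  · linarith [hstep k, mul_le_mul_of_nonneg_left (he k) (hγ.pos k).le,
      mul_le_mul_of_nonneg_left (hrate _ (hx.mem_farRegion hκ hκG hfar)) (hγ.pos k).le]

end Runs

section Convergence

variable {δ ε : ℝ} [FiniteDimensional ℝ E]

theorem isCompact_farRegion : IsCompact (farRegion B δ z) := by
  have hball : IsCompact
      (Metric.closedBall (0 : E) B ×ˢ Metric.closedBall (0 : EuclideanSpace ℝ ι) B) :=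
    (isCompact_closedBall _ _).prod (isCompact_closedBall _ _)
  refine hball.of_isClosed_subset ?_ fun x hx => ⟨by simpa using hx.1, by simpa using hx.2.1⟩
  simp only [farRegion, ofPred_and, ofPred_forall]
  refine (isClosed_le (by fun_prop) (by fun_prop)).inter <|
    (isClosed_le (by fun_prop) (by fun_prop)).inter <|
    (isClosed_iInter fun i => isClosed_le (by fun_prop) (by fun_prop)).inter
    (isClosed_le (by fun_prop) (by fun_prop))

theorem exists_pos_forall_le_rate (hF : Continuous F) (hq : Continuous q)
    (hz : IsProjectedKKT U F G q z)
    (hmono : ∀ h, h ≠ z.1 → 0 < inner ℝ (F h - F z.1) (h - z.1))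
    (hinj : ∀ v, (∀ i, q z.1 i ≠ 0 → v i = 0) → U.starProjection (G v) = 0 → v = 0)
    (hδ : 0 < δ) (B : ℝ) :
    ∃ κ > 0, κ * ‖G‖ ≤ 1 ∧ ∃ θ > 0, ∀ x ∈ farRegion B δ z,
      θ ≤ 2 * gap F q z x + κ * crossRate U F G q z x := by
  obtain ⟨κ₀, hκ₀, hκ⟩ := exists_pos_forall_le_add_mul
    (isCompact_farRegion (B := B) (δ := δ) (z := z))
    ((continuous_gap hF).const_mul 2).continuousOn
    (continuous_crossRate (U := U) (G := G) (z := z) hF hq).continuousOn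
    (fun x hx => mul_nonneg zero_le_two (gap_nonneg hz hmono hx.2.2.1))
    fun x hx hgap => crossRate_pos_of_gap_eq_zero hz hmono hinj hx.2.2.1
      (by rintro rfl; simpa using hδ.trans_le hx.2.2.2) (by linarith)
  refine ⟨min κ₀ (‖G‖ + 1)⁻¹, by positivity, ?_, hκ _ (by positivity) (min_le_left _ _)⟩
  calc min κ₀ (‖G‖ + 1)⁻¹ * ‖G‖ ≤ (‖G‖ + 1)⁻¹ * (‖G‖ + 1) := by
        gcongr
        exacts [min_le_right _ _, by simp]
    _ = 1 := inv_mul_cancel₀ (by positivity)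

theorem exists_lyapunov_step_bound (hF : Continuous F) (hq : Continuous q)
    (hz : IsProjectedKKT U F G q z)
    (hadj : ∀ x y v, inner ℝ (q x - q y) v = inner ℝ (x - y) (G v)) (hκ : 0 ≤ κ) (B : ℝ) :
    ∃ K, 0 ≤ K ∧ ∀ γ, 0 ≤ γ → ∀ β x, ‖β‖ ≤ B → ‖x.1‖ ≤ B → ‖x.2‖ ≤ B → x.1 - z.1 ∈ U →
      (∀ i, 0 ≤ x.2 i) →
      |2 * gap F q z x + κ * crossRate U F G q z x| ≤ K ∧
      lyapunov G κ (primalDualStep U F G q γ β x - z) ≤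
        lyapunov G κ (x - z) - γ * (2 * gap F q z x + κ * crossRate U F G q z x)
          + K * (γ * ‖β‖ + γ ^ 2) := by
  have hcompact : IsCompact (Metric.closedBall (0 : E × E × EuclideanSpace ℝ ι) B) :=
    isCompact_closedBall _ _
  have hgap := continuous_gap (q := q) (z := z) hF
  have hcross := continuous_crossRate (U := U) (G := G) (z := z) hF hq
  obtain ⟨K₁, hK₁⟩ := hcompact.exists_bound_of_continuousOn (f := fun p =>
    2 * gap F q z p.2 + κ * crossRate U F G q z p.2) (by fun_prop)
  obtain ⟨K₂, hK₂⟩ := hcompact.exists_bound_of_continuousOn (f := fun p =>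
    2 * ‖p.2.1 - z.1‖ + κ * ‖G (p.2.2 - z.2)‖) (by fun_prop)
  obtain ⟨K₃, hK₃⟩ := hcompact.exists_bound_of_continuousOn (f := fun p =>
    ‖U.starProjection (F p.2.1 + G p.2.2 + p.1)‖ ^ 2 + ‖q p.2.1‖ ^ 2
      + κ * (‖G‖ * ‖U.starProjection (F p.2.1 + G p.2.2 + p.1)‖ * ‖q p.2.1‖)) (by fun_prop)
  refine ⟨max |K₁| (max K₂ K₃), (abs_nonneg K₁).trans (le_max_left _ _),
    fun γ hγ β x hβ hx₁ hx₂ hxU hx => ?_⟩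
  have hp : (β, x) ∈ Metric.closedBall (0 : E × E × EuclideanSpace ℝ ι) B := by
    simp [Prod.norm_def, hβ, hx₁, hx₂]
  have hK₂' : _ ≤ max |K₁| (max K₂ K₃) := (le_abs_self _).trans <| (hK₂ _ hp).trans <|
    (le_max_left _ _).trans (le_max_right _ _)
  have hK₃' : _ ≤ max |K₁| (max K₂ K₃) := (le_abs_self _).trans <| (hK₃ _ hp).trans <|
    (le_max_right _ _).trans (le_max_right _ _)
  refine ⟨(hK₁ _ hp).trans ((le_abs_self K₁).trans (le_max_left _ _)),
    (lyapunov_primalDualStep_le hz hadj hκ hγ hxU hx).trans ?_⟩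
  linarith [mul_le_mul_of_nonneg_left hK₂' (mul_nonneg hγ (norm_nonneg β)),
    mul_le_mul_of_nonneg_left hK₃' (sq_nonneg γ)]

theorem exists_error_tolerance (hF : Continuous F) (hq : Continuous q)
    (hz : IsProjectedKKT U F G q z)
    (hadj : ∀ x y v, inner ℝ (q x - q y) v = inner ℝ (x - y) (G v))
    (hmono : ∀ h, h ≠ z.1 → 0 < inner ℝ (F h - F z.1) (h - z.1))
    (hinj : ∀ v, (∀ i, q z.1 i ≠ 0 → v i = 0) → U.starProjection (G v) = 0 → v = 0)
    (hε : 0 < ε) (B : ℝ) :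
    ∃ τ > 0, ∀ (γ : ℕ → ℝ) (β : ℕ → E) (x : ℕ → E × EuclideanSpace ℝ ι) (e : ℕ → ℝ) (a : ℝ),
      IsRobbinsMonro γ → IsBoundedRun U F G q z B γ β x → (∀ k, e k ≤ τ) →
      Tendsto (fun K => ∑ k ∈ Finset.range K, γ k * (‖β k‖ - e k)) atTop (𝓝 a) →
      ∀ᶠ k in atTop, ‖(x k).1 - z.1‖ ≤ ε := by
  obtain ⟨κ, hκ, hκG, θ, hθ, hrate⟩ := exists_pos_forall_le_rate (δ := ε ^ 2 / 8) hF hq hz hmono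
    hinj (by positivity) B
  obtain ⟨K, hK, hstep⟩ := exists_lyapunov_step_bound hF hq hz hadj hκ.le B
  refine ⟨θ / (2 * (K + 1)), by positivity, fun γ β x e a hγ hx he ha => ?_⟩
  have hxstep (k : ℕ) := hstep (γ k) (hγ.pos k).le (β k) (x k) (hx.norm_error_le k)
    (hx.norm_fst_le k) (hx.norm_snd_le k) (hx.fst_sub_mem k) (hx.snd_nonneg k)
  simp only [← hx.step] at hxstep
  have hKe (k : ℕ) : K * e k ≤ θ / 2 := calc
    K * e k ≤ (K + 1) * (θ / (2 * (K + 1))) :=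
      (mul_le_mul_of_nonneg_left (he k) hK).trans (by gcongr; linarith)
    _ = θ / 2 := by field_simp
  filter_upwards [hx.eventually_lyapunov_le hγ hκ.le hκG (by positivity) hθ hrate
    (fun k => (hxstep k).1) (fun k => (hxstep k).2) hKe ha] with k hk
  have hV := abs_le.1 (abs_lyapunov_sub_le hκ.le hκG (x k - z))
  rw [Prod.fst_sub, Prod.snd_sub] at hV
  refine le_of_sq_le_sq ?_ hε.le
  linarith [sq_nonneg ‖(x k).2 - z.2‖]

end Convergence

end PrimalDual

/-! ### Conditional value-at-risk and tail probabilities -/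

section CVaR

variable {X Y : Type*} [MeasurableSpace X] [MeasurableSpace Y] {P : Measure X} {Q : Measure Y}
  {Z : X → ℝ} {W : Y → ℝ} {α a b t : ℝ}

theorem integrable_max_sub [IsFiniteMeasure P] (hZ : Integrable Z P) (η : ℝ) :
    Integrable (fun x => max (Z x - η) 0) P :=
  (hZ.sub (integrable_const η)).pos_part

theorem integral_max_sub_nonneg (η : ℝ) : 0 ≤ ∫ x, max (Z x - η) 0 ∂P :=
  integral_nonneg fun _ => le_max_right _ _

section Bounds

variable [IsProbabilityMeasure P]

theorem le_cvarObjective (hα₀ : 0 < α) (hα₁ : α ≤ 1) (hZ : Integrable Z P)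
    (ht : ∀ᵐ x ∂P, t ≤ Z x) (η : ℝ) : t ≤ cvarObjective α P Z η := by
  have hmean : t - η ≤ ∫ x, max (Z x - η) 0 ∂P := by
    simpa using integral_mono_ae (integrable_const (t - η)) (integrable_max_sub hZ η)
      (ht.mono fun x hx => (sub_le_sub_right hx η).trans (le_max_left _ _))
  have hscale := le_mul_of_one_le_left (integral_max_sub_nonneg (P := P) (Z := Z) η)
    ((one_le_inv₀ hα₀).2 hα₁)
  rw [cvarObjective]
  linarith

theorem bddBelow_range_cvarObjective (hα₀ : 0 < α) (hα₁ : α ≤ 1) (hZ : Integrable Z P)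
    (ht : ∀ᵐ x ∂P, t ≤ Z x) : BddBelow (range (cvarObjective α P Z)) :=
  ⟨t, forall_mem_range.2 (le_cvarObjective hα₀ hα₁ hZ ht)⟩

theorem le_CVaR (hα₀ : 0 < α) (hα₁ : α ≤ 1) (hZ : Integrable Z P) (ht : ∀ᵐ x ∂P, t ≤ Z x) :
    t ≤ CVaR α P Z :=
  le_ciInf (le_cvarObjective hα₀ hα₁ hZ ht)

end Bounds

theorem CVaR_le (hbdd : BddBelow (range (cvarObjective α P Z))) (ht : ∀ᵐ x ∂P, Z x ≤ t) :
    CVaR α P Z ≤ t := by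
  refine (ciInf_le hbdd t).trans_eq ?_
  rw [cvarObjective, integral_eq_zero_of_ae, mul_zero, add_zero]
  filter_upwards [ht] with x hx
  exact max_eq_right (sub_nonpos.2 hx)

section Tail

theorem antitone_measureReal_lt [IsFiniteMeasure P] : Antitone fun t => P.real {x | t < Z x} :=
  fun _ _ hst => measureReal_mono fun _ hx => hst.trans_lt hx

theorem measureReal_lt_eq_one [IsProbabilityMeasure P] (hZ : ∀ᵐ x ∂P, a ≤ Z x) (ht : t < a) :
    P.real {x | t < Z x} = 1 :=
  (measureReal_congr (eventuallyEq_univ.2 (hZ.mono fun _ hx => ht.trans_le hx))).trans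
    probReal_univ

theorem measureReal_lt_eq_zero (hZ : ∀ᵐ x ∂P, Z x ≤ b) (ht : b ≤ t) :
    P.real {x | t < Z x} = 0 := by
  rw [measureReal_def, measure_eq_zero_iff_ae_notMem.2, ENNReal.toReal_zero]
  exact hZ.mono fun _ hx => (hx.trans ht).not_gt

theorem integrableOn_measureReal_lt [IsFiniteMeasure P] (hZ : ∀ᵐ x ∂P, Z x ≤ b) (η : ℝ) :
    IntegrableOn (fun t => P.real {x | t < Z x}) (Ioi η) := by
  refine ((antitone_measureReal_lt.antitoneOn (Icc η b)).integrableOn_isCompact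
    isCompact_Icc).of_forall_sdiff_eq_zero measurableSet_Ioi fun t ht => ?_
  exact measureReal_lt_eq_zero hZ (not_lt.1 fun htb => ht.2 ⟨ht.1.le, htb.le⟩)

theorem integral_max_sub_eq_setIntegral_Ioi [IsFiniteMeasure P] (hZ : Integrable Z P) (η : ℝ) :
    ∫ x, max (Z x - η) 0 ∂P = ∫ t in Ioi η, P.real {x | t < Z x} := by
  rw [(integrable_max_sub hZ η).integral_eq_integral_meas_lt (.of_forall fun _ => le_max_right _ _),
    ← (measurePreserving_add_right volume η).setIntegral_preimage_emb
      (measurableEmbedding_addRight η) (fun t => P.real {x | t < Z x}),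
    preimage_add_const_Ioi, sub_self]
  refine setIntegral_congr_fun measurableSet_Ioi fun t (ht : 0 < t) => ?_
  simp only [lt_max_iff, not_lt_of_gt ht, or_false, lt_sub_iff_add_lt]

theorem abs_integral_max_sub_sub_le [IsProbabilityMeasure P] [IsProbabilityMeasure Q]
    (hZi : Integrable Z P) (hWi : Integrable W Q)
    (hZ : ∀ᵐ x ∂P, Z x ∈ Icc a b) (hW : ∀ᵐ y ∂Q, W y ∈ Icc a b) (η : ℝ) :
    |∫ x, max (Z x - η) 0 ∂P - ∫ y, max (W y - η) 0 ∂Q| ≤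
      ∫ t in Icc a b, |P.real {x | t < Z x} - Q.real {y | t < W y}| := by
  have hZη := integrableOn_measureReal_lt (hZ.mono fun _ hx => hx.2) η
  have hWη := integrableOn_measureReal_lt (hW.mono fun _ hx => hx.2) η
  have hab : IntegrableOn (fun t => |P.real {x | t < Z x} - Q.real {y | t < W y}|) (Icc a b) :=
    (((antitone_measureReal_lt.antitoneOn _).integrableOn_isCompact isCompact_Icc).sub
      ((antitone_measureReal_lt.antitoneOn _).integrableOn_isCompact isCompact_Icc)).abs
  have hzero : ∀ t ∉ Icc a b, |P.real {x | t < Z x} - Q.real {y | t < W y}| = 0 := by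
    intro t ht
    rcases lt_or_ge t a with hta | hta
    · rw [measureReal_lt_eq_one (hZ.mono fun _ hx => hx.1) hta,
        measureReal_lt_eq_one (hW.mono fun _ hx => hx.1) hta, sub_self, abs_zero]
    · have hbt : b ≤ t := not_lt.1 fun htb => ht ⟨hta, htb.le⟩
      rw [measureReal_lt_eq_zero (hZ.mono fun _ hx => hx.2) hbt,
        measureReal_lt_eq_zero (hW.mono fun _ hx => hx.2) hbt, sub_self, abs_zero]
  rw [integral_max_sub_eq_setIntegral_Ioi hZi, integral_max_sub_eq_setIntegral_Ioi hWi,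
    ← integral_sub hZη hWη]
  calc |∫ t in Ioi η, (P.real {x | t < Z x} - Q.real {y | t < W y})|
      ≤ ∫ t in Ioi η, |P.real {x | t < Z x} - Q.real {y | t < W y}| := abs_integral_le_integral_abs
    _ ≤ ∫ t, |P.real {x | t < Z x} - Q.real {y | t < W y}| :=
        setIntegral_le_integral
          ((integrableOn_iff_integrable_of_support_subset
            (Function.support_subset_iff'.2 hzero)).1 hab)
          (.of_forall fun _ => abs_nonneg _)
    _ = ∫ t in Icc a b, |P.real {x | t < Z x} - Q.real {y | t < W y}| :=
        (setIntegral_eq_integral_of_forall_compl_eq_zero hzero).symm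

end Tail

theorem CVaR_le_CVaR_add (hα₀ : 0 < α) {δ : ℝ} (hbdd : BddBelow (range (cvarObjective α P Z)))
    (hδ : ∀ η, |∫ x, max (Z x - η) 0 ∂P - ∫ y, max (W y - η) 0 ∂Q| ≤ δ) :
    CVaR α P Z ≤ CVaR α Q W + α⁻¹ * δ := by
  rw [← sub_le_iff_le_add]
  refine le_ciInf fun η => sub_le_iff_le_add.2 ((ciInf_le hbdd η).trans ?_)
  rw [cvarObjective, cvarObjective, add_assoc, ← mul_add]
  gcongr
  linarith [le_of_abs_le (hδ η)]

/-- The integral is the Wasserstein distance of the distributions of `Z` and `W`. -/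
theorem abs_CVaR_sub_CVaR_le [IsProbabilityMeasure P] [IsProbabilityMeasure Q]
    (hα₀ : 0 < α) (hα₁ : α ≤ 1) (hZi : Integrable Z P) (hWi : Integrable W Q)
    (hZ : ∀ᵐ x ∂P, Z x ∈ Icc a b) (hW : ∀ᵐ y ∂Q, W y ∈ Icc a b) :
    |CVaR α P Z - CVaR α Q W| ≤
      α⁻¹ * ∫ t in Icc a b, |P.real {x | t < Z x} - Q.real {y | t < W y}| := by
  have hδ := abs_integral_max_sub_sub_le hZi hWi hZ hW
  have hPQ := CVaR_le_CVaR_add hα₀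
    (bddBelow_range_cvarObjective hα₀ hα₁ hZi (hZ.mono fun _ hx => hx.1)) hδ
  have hQP := CVaR_le_CVaR_add hα₀
    (bddBelow_range_cvarObjective hα₀ hα₁ hWi (hW.mono fun _ hx => hx.1))
    fun η => (abs_sub_comm _ _).trans_le (hδ η)
  exact abs_sub_le_iff.2 ⟨by linarith, by linarith⟩

end CVaR

section Empirical

variable {α t : ℝ} {N : ℕ} [NeZero N] {z : ℕ → ℝ}

/-- The uniform distribution on the indices of `N` samples. -/
def uniformFin (N : ℕ) [NeZero N] : Measure (Fin N) :=
  (PMF.uniformOfFintype (Fin N)).toMeasure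

instance : IsProbabilityMeasure (uniformFin N) :=
  PMF.toMeasure.isProbabilityMeasure _

theorem integral_uniformFin (f : Fin N → ℝ) :
    ∫ j, f j ∂uniformFin N = (N : ℝ)⁻¹ * ∑ j, f j := by
  simp [uniformFin, PMF.integral_eq_sum, Finset.mul_sum]

theorem empCVaR_eq_CVaR (z : ℕ → ℝ) : empCVaR α N z = CVaR α (uniformFin N) fun j => z j := by
  simp only [empCVaR, CVaR, cvarObjective, integral_uniformFin, mul_inv_rev, mul_assoc,
    Finset.sum_range]

theorem bddBelow_range_cvarObjective_uniformFin (hα₀ : 0 < α) (hα₁ : α ≤ 1) (f : Fin N → ℝ) :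
    BddBelow (range (cvarObjective α (uniformFin N) f)) := by
  obtain ⟨j₀, hj₀⟩ := Finite.exists_min f
  exact bddBelow_range_cvarObjective hα₀ hα₁ .of_finite (.of_forall hj₀)

theorem lt_empCVaR (hα₀ : 0 < α) (hα₁ : α ≤ 1) (hz : ∀ j < N, t < z j) : t < empCVaR α N z := by
  obtain ⟨j₀, hj₀⟩ := Finite.exists_min fun j : Fin N => z j
  rw [empCVaR_eq_CVaR]
  exact (hz j₀ j₀.isLt).trans_le (le_CVaR hα₀ hα₁ .of_finite (.of_forall hj₀))

theorem empCVaR_lt (hα₀ : 0 < α) (hα₁ : α ≤ 1) (hz : ∀ j < N, z j < t) : empCVaR α N z < t := by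
  obtain ⟨j₀, hj₀⟩ := Finite.exists_max fun j : Fin N => z j
  rw [empCVaR_eq_CVaR]
  exact (CVaR_le (bddBelow_range_cvarObjective_uniformFin hα₀ hα₁ _) (.of_forall hj₀)).trans_lt
    (hz j₀ j₀.isLt)

theorem measurable_empCVaR (hα₀ : 0 < α) (hα₁ : α ≤ 1) : Measurable (empCVaR α N) := by
  refine measurable_of_Ici fun t => IsClosed.measurableSet ?_
  have hsuperlevel : empCVaR α N ⁻¹' Ici t =
      ⋂ η, {z | t ≤ cvarObjective α (uniformFin N) (fun j => z j) η} := by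
    ext z
    simp only [mem_preimage, mem_Ici, mem_iInter, mem_ofPred_eq, empCVaR_eq_CVaR]
    exact le_ciInf_iff (bddBelow_range_cvarObjective_uniformFin hα₀ hα₁ _)
  rw [hsuperlevel]
  refine isClosed_iInter fun η => isClosed_le continuous_const ?_
  simp only [cvarObjective, integral_uniformFin]
  fun_prop

theorem measureReal_uniformFin (s : Set (Fin N)) :
    (uniformFin N).real s = (N : ℝ)⁻¹ * ∑ j, s.indicator 1 j := by
  rw [← integral_uniformFin, integral_indicator_one s.toFinite.measurableSet]

end Empirical

/-! ### Mean error of the empirical estimate -/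

section Sampling

variable {ι κ Ω X : Type*} [MeasurableSpace Ω] [MeasurableSpace X] {μ : Measure Ω} {P : Measure X}

/-- `ξ` is a family of independent random variables with common distribution `P`. -/
structure IsIIDSample (ξ : ι → Ω → X) (P : Measure X) (μ : Measure Ω) : Prop where
  measurable : ∀ j, Measurable (ξ j)
  map_eq : ∀ j, μ.map (ξ j) = P
  iIndepFun : iIndepFun ξ μ

namespace IsIIDSample

theorem precomp {ξ : ι → Ω → X} (hξ : IsIIDSample ξ P μ) {g : κ → ι} (hg : g.Injective) :
    IsIIDSample (fun k => ξ (g k)) P μ where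
  measurable k := hξ.measurable (g k)
  map_eq k := hξ.map_eq (g k)
  iIndepFun := hξ.iIndepFun.precomp hg

variable {N : ℕ} {ξ : ℕ → Ω → X} {Z : X → ℝ} {α a b c B : ℝ}

theorem measure_eq_zero_of_ae_exists_notMem (hξ : IsIIDSample ξ P μ) {D : Set X}
    (hD : MeasurableSet D) (h : ∀ᵐ ω ∂μ, ¬ ∀ j < N, ξ j ω ∈ D) : P D = 0 := by
  have hprod : μ (⋂ j ∈ Finset.range N, ξ j ⁻¹' D) = P D ^ N := by
    rw [hξ.iIndepFun.measure_inter_preimage_eq_mul (Finset.range N) (sets := fun _ => D)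
      fun _ _ => hD]
    simp only [← Measure.map_apply (hξ.measurable _) hD, hξ.map_eq, Finset.prod_const,
      Finset.card_range]
  refine eq_zero_of_pow_eq_zero (hprod.symm.trans ?_)
  rw [measure_eq_zero_iff_ae_notMem]
  simpa only [mem_iInter, Finset.mem_range, mem_preimage] using h

theorem ae_mem_Icc_of_abs_empCVaR_sub_le [NeZero N] (hξ : IsIIDSample ξ P μ) (hα₀ : 0 < α)
    (hα₁ : α ≤ 1) (hZ : Measurable Z)
    (h : ∀ᵐ ω ∂μ, |empCVaR α N (fun j => Z (ξ j ω)) - c| ≤ B) :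
    ∀ᵐ x ∂P, Z x ∈ Icc (c - B) (c + B) := by
  have hupper : P {x | c + B < Z x} = 0 := by
    refine hξ.measure_eq_zero_of_ae_exists_notMem (N := N)
      (measurableSet_lt measurable_const hZ) ?_
    filter_upwards [h] with ω hω hall
    have := lt_empCVaR hα₀ hα₁ (z := fun j => Z (ξ j ω)) hall
    linarith [(abs_le.1 hω).2]
  have hlower : P {x | Z x < c - B} = 0 := by
    refine hξ.measure_eq_zero_of_ae_exists_notMem (N := N)
      (measurableSet_lt hZ measurable_const) ?_
    filter_upwards [h] with ω hω hall
    have := empCVaR_lt hα₀ hα₁ (z := fun j => Z (ξ j ω)) hall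
    linarith [(abs_le.1 hω).1]
  filter_upwards [measure_eq_zero_iff_ae_notMem.1 hupper, measure_eq_zero_iff_ae_notMem.1 hlower]
    with x hxu hxl
  exact ⟨not_lt.1 hxl, not_lt.1 hxu⟩

end IsIIDSample

theorem integral_abs_le_sqrt_integral_sq [IsProbabilityMeasure μ] {f : Ω → ℝ}
    (hf : MemLp f 2 μ) : ∫ ω, |f ω| ∂μ ≤ √(∫ ω, f ω ^ 2 ∂μ) := by
  refine Real.le_sqrt_of_sq_le (sub_nonneg.1 ?_)
  simpa only [variance_eq_sub hf.abs, Pi.pow_apply, Pi.abs_apply, sq_abs] using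
    variance_nonneg |f| μ

theorem integral_abs_mean_sub_le [IsProbabilityMeasure μ] {N : ℕ} [NeZero N]
    {Y : Fin N → Ω → ℝ} {m v : ℝ} (hY : ∀ j, MemLp (Y j) 2 μ)
    (hind : Pairwise fun i j => IndepFun (Y i) (Y j) μ) (hm : ∀ j, ∫ ω, Y j ω ∂μ = m)
    (hv : ∀ j, variance (Y j) μ ≤ v) :
    ∫ ω, |(N : ℝ)⁻¹ * ∑ j, Y j ω - m| ∂μ ≤ √(v / N) := by
  have hN : (N : ℝ) ≠ 0 := NeZero.ne _
  have hmean : MemLp (fun ω => (N : ℝ)⁻¹ * ∑ j, Y j ω) 2 μ :=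
    (memLp_finsetSum _ fun j _ => hY j).const_mul _
  have hexp : ∫ ω, (N : ℝ)⁻¹ * ∑ j, Y j ω ∂μ = m := by
    rw [integral_const_mul, integral_finsetSum _ fun j _ => (hY j).integrable one_le_two]
    simp [hm, hN]
  have hsum : variance (fun ω => ∑ j, Y j ω) μ ≤ N * v := by
    rw [← Finset.sum_fn, IndepFun.variance_sum (fun j _ => hY j) fun i _ j _ hij => hind hij]
    simpa using Finset.sum_le_card_nsmul _ _ _ fun j (_ : j ∈ Finset.univ) => hv j
  refine (integral_abs_le_sqrt_integral_sq (hmean.sub (memLp_const m))).trans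
    (Real.sqrt_le_sqrt ?_)
  calc ∫ ω, ((N : ℝ)⁻¹ * ∑ j, Y j ω - m) ^ 2 ∂μ
      = variance (fun ω => (N : ℝ)⁻¹ * ∑ j, Y j ω) μ := by
        rw [variance_eq_integral hmean.aestronglyMeasurable.aemeasurable, hexp]
    _ ≤ (N : ℝ)⁻¹ ^ 2 * (N * v) := by rw [variance_const_mul]; gcongr
    _ = v / N := by field_simp

namespace IsIIDSample

variable [IsProbabilityMeasure μ] {N : ℕ} [NeZero N] {ξ : ℕ → Ω → X} {Z : X → ℝ} {α a b c B : ℝ}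

theorem integral_abs_frequency_sub_le (hξ : IsIIDSample ξ P μ) {D : Set X}
    (hD : MeasurableSet D) :
    ∫ ω, |(uniformFin N).real {j | ξ j ω ∈ D} - P.real D| ∂μ ≤ (2 * √N)⁻¹ := by
  have hmeas : Measurable (D.indicator (1 : X → ℝ)) := measurable_one.indicator hD
  have hbdd : ∀ j : Fin N, ∀ᵐ ω ∂μ, D.indicator (1 : X → ℝ) (ξ j ω) ∈ Icc 0 1 := fun j =>
    .of_forall fun ω => ⟨indicator_nonneg (fun _ _ => zero_le_one) _,
      indicator_le_self' (fun _ _ => zero_le_one) _⟩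
  have hsample : ∀ j : Fin N, Measurable fun ω => D.indicator (1 : X → ℝ) (ξ j ω) := fun j =>
    hmeas.comp (hξ.measurable j)
  have hsqrt : √((1 / 2) ^ 2 / N) = (2 * √N)⁻¹ := by
    rw [Real.sqrt_div (sq_nonneg _), Real.sqrt_sq one_half_pos.le, mul_inv, one_div, div_eq_mul_inv]
  simp only [measureReal_uniformFin]
  rw [← hsqrt]
  refine integral_abs_mean_sub_le (fun j => memLp_of_bounded (hbdd j)
    (hsample j).aestronglyMeasurable 2) (fun i j hij => (hξ.iIndepFun.indepFun
      (Fin.val_injective.ne hij)).comp hmeas hmeas) (fun j => ?_) fun j =>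
    (variance_le_sq_of_bounded (hbdd j) (hsample j).aemeasurable).trans_eq (by rw [sub_zero])
  change ∫ ω, D.indicator (1 : X → ℝ) (ξ j ω) ∂μ = P.real D
  rw [← integral_map (hξ.measurable j).aemeasurable hmeas.aestronglyMeasurable, hξ.map_eq,
    integral_indicator_one hD]

theorem integrable_abs_frequency_sub [IsProbabilityMeasure P] (hξ : IsIIDSample ξ P μ)
    (hZ : Measurable Z) {ν : Measure ℝ} [IsFiniteMeasure ν] :
    Integrable (fun p : Ω × ℝ =>
      |(uniformFin N).real {j | p.2 < Z (ξ j p.1)} - P.real {x | p.2 < Z x}|) (μ.prod ν) := by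
  have hset : MeasurableSet {p : (Ω × ℝ) × Fin N | p.1.2 < Z (ξ p.2 p.1.1)} :=
    measurableSet_lt (by fun_prop) (measurable_from_prod_countable_left fun j =>
      hZ.comp ((hξ.measurable j).comp measurable_fst))
  have hmeas := ((measurable_measure_prodMk_left (ν := uniformFin N) hset).ennreal_toReal.sub
    ((antitone_measureReal_lt (P := P) (Z := Z)).measurable.comp measurable_snd)).abs
  refine .of_bound hmeas.aestronglyMeasurable 1 (.of_forall fun p => ?_)
  rw [Real.norm_eq_abs, abs_abs, abs_sub_le_iff]
  constructor <;> linarith [measureReal_nonneg (μ := P) (s := {x | p.2 < Z x}),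
    measureReal_le_one (μ := P) (s := {x | p.2 < Z x}),
    measureReal_nonneg (μ := uniformFin N) (s := {j | p.2 < Z (ξ j p.1)}),
    measureReal_le_one (μ := uniformFin N) (s := {j | p.2 < Z (ξ j p.1)})]

theorem integral_abs_empCVaR_sub_le [IsProbabilityMeasure P] (hξ : IsIIDSample ξ P μ)
    (hα₀ : 0 < α) (hα₁ : α ≤ 1) (hZ : Measurable Z) (hZab : ∀ᵐ x ∂P, Z x ∈ Icc a b) :
    ∫ ω, |empCVaR α N (fun j => Z (ξ j ω)) - CVaR α P Z| ∂μ ≤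
      α⁻¹ * ((b - a) * (2 * √N)⁻¹) := by
  let f : Ω → ℝ → ℝ := fun ω t =>
    |(uniformFin N).real {j | t < Z (ξ j ω)} - P.real {x | t < Z x}|
  have hpointwise : ∀ᵐ ω ∂μ, |empCVaR α N (fun j => Z (ξ j ω)) - CVaR α P Z| ≤
      α⁻¹ * ∫ t in Icc a b, f ω t := by
    have hsample : ∀ j, ∀ᵐ ω ∂μ, Z (ξ j ω) ∈ Icc a b := fun j =>
      ae_of_ae_map (hξ.measurable j).aemeasurable (by rwa [hξ.map_eq])
    filter_upwards [ae_all_iff.2 hsample] with ω hω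
    rw [empCVaR_eq_CVaR]
    exact abs_CVaR_sub_CVaR_le hα₀ hα₁ .of_finite
      (.of_mem_Icc a b hZ.aemeasurable hZab) (.of_forall fun j => hω j) hZab
  have hfint : Integrable (Function.uncurry f) (μ.prod (volume.restrict (Icc a b))) :=
    hξ.integrable_abs_frequency_sub hZ
  have hab : a ≤ b := hZab.exists.elim fun x hx => hx.1.trans hx.2
  calc ∫ ω, |empCVaR α N (fun j => Z (ξ j ω)) - CVaR α P Z| ∂μ
      ≤ ∫ ω, (α⁻¹ * ∫ t in Icc a b, f ω t) ∂μ :=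
        integral_mono_of_nonneg (.of_forall fun _ => abs_nonneg _)
          (hfint.integral_prod_left.const_mul _) hpointwise
    _ = α⁻¹ * ∫ t in Icc a b, ∫ ω, f ω t ∂μ := by
        rw [integral_const_mul, integral_integral_swap hfint]
    _ ≤ α⁻¹ * ∫ t in Icc a b, (2 * √N)⁻¹ := by
        gcongr ?_ * ?_
        exact integral_mono hfint.integral_prod_right (integrable_const _) fun t =>
          hξ.integral_abs_frequency_sub_le (D := {x | t < Z x})
            (measurableSet_lt measurable_const hZ)
    _ = α⁻¹ * ((b - a) * (2 * √N)⁻¹) := by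
        rw [setIntegral_const, Real.volume_real_Icc_of_le hab, smul_eq_mul]

end IsIIDSample

end Sampling

section EstError

variable {n m : ℕ} {C : Vec n → Vec m → Vec n} {P : Measure (Vec m)} {α : ℝ}

theorem measurable_cost_apply (hC : Measurable (Function.uncurry C)) (h : Vec n) (i : Fin n) :
    Measurable fun x => C h x i :=
  (measurable_pi_apply i).comp
    ((WithLp.measurable_ofLp 2 _).comp (hC.comp measurable_prodMk_left))

theorem norm_le_sum_abs {ι : Type*} [Fintype ι] (v : EuclideanSpace ℝ ι) :
    ‖v‖ ≤ ∑ i, |v i| := by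
  rw [EuclideanSpace.norm_eq]
  exact Real.sqrt_le_iff.2 ⟨Finset.sum_nonneg fun i _ => abs_nonneg _,
    Finset.sum_sq_le_sq_sum_of_nonneg fun i _ => abs_nonneg _⟩

theorem IsIIDSample.integral_norm_estError_le [IsProbabilityMeasure P] {Ω : Type*}
    [MeasurableSpace Ω] {μ : Measure Ω} [IsProbabilityMeasure μ] {N : ℕ} [NeZero N]
    {ξ : ℕ → Ω → Vec m} {B : ℝ} (hξ : IsIIDSample ξ P μ) (hC : Measurable (Function.uncurry C))
    (hα₀ : 0 < α) (hα₁ : α ≤ 1) {h : Vec n}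
    (hB : ∀ᵐ ω ∂μ, ‖estError α P C N (fun j => ξ j ω) h‖ ≤ B) :
    ∫ ω, ‖estError α P C N (fun j => ξ j ω) h‖ ∂μ ≤ n * (α⁻¹ * (B / √N)) := by
  set e : Fin n → Ω → ℝ := fun i ω => |estError α P C N (fun j => ξ j ω) h i|
  have heB : ∀ i, ∀ᵐ ω ∂μ, e i ω ≤ B := fun i =>
    hB.mono fun ω hω => (PiLp.norm_apply_le (estError α P C N (fun j => ξ j ω) h) i).trans hω
  have hemeas : ∀ i, Measurable (e i) := fun i =>
    (((measurable_empCVaR hα₀ hα₁).comp (measurable_pi_iff.2 fun j =>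
      (measurable_cost_apply hC h i).comp (hξ.measurable j))).sub_const _).abs
  have heint : ∀ i, Integrable (e i) μ := fun i =>
    .of_mem_Icc 0 B (hemeas i).aemeasurable ((heB i).mono fun ω hω => ⟨abs_nonneg _, hω⟩)
  have hemean : ∀ i, ∫ ω, e i ω ∂μ ≤ α⁻¹ * (B / √N) := fun i => by
    have hZ := measurable_cost_apply hC h i
    refine (hξ.integral_abs_empCVaR_sub_le hα₀ hα₁ hZ
      (hξ.ae_mem_Icc_of_abs_empCVaR_sub_le hα₀ hα₁ hZ (heB i))).trans_eq ?_
    rw [mul_inv]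
    ring
  calc ∫ ω, ‖estError α P C N (fun j => ξ j ω) h‖ ∂μ
      ≤ ∫ ω, ∑ i, e i ω ∂μ :=
        integral_mono_of_nonneg (.of_forall fun ω => norm_nonneg _)
          (integrable_finsetSum _ fun i _ => heint i) (.of_forall fun ω => norm_le_sum_abs _)
    _ = ∑ i, ∫ ω, e i ω ∂μ := integral_finsetSum _ fun i _ => heint i
    _ ≤ n * (α⁻¹ * (B / √N)) := by
        simpa using Finset.sum_le_card_nsmul _ _ _ fun i (_ : i ∈ Finset.univ) => hemean i

end EstError

/-! ### Fluctuations of adapted errors -/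

section MartingaleDifference

variable {Ω : Type*} {m₀ : MeasurableSpace Ω} {μ : Measure Ω} {ℱ : Filtration ℕ m₀}
  {D X : ℕ → Ω → ℝ} {γ : ℕ → ℝ} {B : ℝ}

/-- Square-integrable martingale differences, where `D k` is revealed at time `k + 1`. -/
structure IsMartingaleDifference (D : ℕ → Ω → ℝ) (ℱ : Filtration ℕ m₀) (μ : Measure Ω) : Prop where
  stronglyMeasurable : ∀ k, StronglyMeasurable[ℱ (k + 1)] (D k)
  memLp : ∀ k, MemLp (D k) 2 μ
  condExp_eq_zero : ∀ k, μ[D k|ℱ k] =ᵐ[μ] 0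

namespace IsMartingaleDifference

theorem stronglyMeasurable_sum (hD : IsMartingaleDifference D ℱ μ) (n : ℕ) :
    StronglyMeasurable[ℱ n] fun ω => ∑ k ∈ Finset.range n, D k ω :=
  Finset.stronglyMeasurable_fun_sum _ fun k hk =>
    (hD.stronglyMeasurable k).mono (ℱ.mono (Finset.mem_range.1 hk))

theorem memLp_sum (hD : IsMartingaleDifference D ℱ μ) (n : ℕ) :
    MemLp (fun ω => ∑ k ∈ Finset.range n, D k ω) 2 μ :=
  memLp_finsetSum _ fun k _ => hD.memLp k

variable [IsProbabilityMeasure μ]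

theorem martingale_sum (hD : IsMartingaleDifference D ℱ μ) :
    Martingale (fun n ω => ∑ k ∈ Finset.range n, D k ω) ℱ μ := by
  refine martingale_of_condExp_sub_eq_zero_nat hD.stronglyMeasurable_sum
    (fun n => (hD.memLp_sum n).integrable one_le_two) fun n => ?_
  convert hD.condExp_eq_zero n using 2
  ext ω
  simp [Finset.sum_range_succ]

theorem integral_mul_eq_zero (hD : IsMartingaleDifference D ℱ μ) {n : ℕ} {M : Ω → ℝ}
    (hM : StronglyMeasurable[ℱ n] M) (hM₂ : MemLp M 2 μ) : ∫ ω, M ω * D n ω ∂μ = 0 := by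
  have hpull := condExp_mul_of_stronglyMeasurable_left hM (hM₂.integrable_mul (hD.memLp n))
    ((hD.memLp n).integrable one_le_two)
  calc ∫ ω, M ω * D n ω ∂μ = ∫ ω, (μ[M * D n|ℱ n]) ω ∂μ := (integral_condExp (ℱ.le n)).symm
    _ = 0 := integral_eq_zero_of_ae <| by
        filter_upwards [hpull, hD.condExp_eq_zero n] with ω hω hzero
        rw [hω, Pi.mul_apply, hzero, Pi.zero_apply, mul_zero]

theorem integral_sum_sq (hD : IsMartingaleDifference D ℱ μ) (n : ℕ) :
    ∫ ω, (∑ k ∈ Finset.range n, D k ω) ^ 2 ∂μ = ∑ k ∈ Finset.range n, ∫ ω, D k ω ^ 2 ∂μ := by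
  induction n with
  | zero => simp
  | succ n ih =>
    have hM := hD.memLp_sum n
    have hcross := hD.integral_mul_eq_zero (hD.stronglyMeasurable_sum n) hM
    have hcrossi : Integrable (fun ω => 2 * ((∑ k ∈ Finset.range n, D k ω) * D n ω)) μ :=
      (hM.integrable_mul (hD.memLp n)).const_mul 2
    simp only [Finset.sum_range_succ, add_sq, mul_assoc]
    rw [integral_add (by exact hM.integrable_sq.add hcrossi) (hD.memLp n).integrable_sq,
      integral_add hM.integrable_sq hcrossi, integral_const_mul, ih, hcross, mul_zero, add_zero]

theorem ae_exists_tendsto_sum (hD : IsMartingaleDifference D ℱ μ)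
    (hsum : Summable fun k => ∫ ω, D k ω ^ 2 ∂μ) :
    ∀ᵐ ω ∂μ, ∃ a, Tendsto (fun n => ∑ k ∈ Finset.range n, D k ω) atTop (𝓝 a) := by
  refine hD.martingale_sum.submartingale.exists_ae_tendsto_of_bdd
    (R := Real.toNNReal √(∑' k, ∫ ω, D k ω ^ 2 ∂μ)) fun n => ?_
  rw [eLpNorm_one_eq_lintegral_enorm, ← ofReal_integral_norm_eq_lintegral_enorm
    ((hD.memLp_sum n).integrable one_le_two)]
  refine ENNReal.ofReal_le_ofReal ?_
  calc ∫ ω, ‖∑ k ∈ Finset.range n, D k ω‖ ∂μ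
      ≤ √(∫ ω, (∑ k ∈ Finset.range n, D k ω) ^ 2 ∂μ) :=
        integral_abs_le_sqrt_integral_sq (hD.memLp_sum n)
    _ ≤ √(∑' k, ∫ ω, D k ω ^ 2 ∂μ) := by
        rw [hD.integral_sum_sq]
        exact Real.sqrt_le_sqrt
          (hsum.sum_le_tsum _ fun k _ => integral_nonneg fun ω => sq_nonneg _)

end IsMartingaleDifference

theorem condExp_sub_condExp [IsFiniteMeasure μ] {m : MeasurableSpace Ω} (hm : m ≤ m₀) {f : Ω → ℝ}
    (hf : Integrable f μ) : μ[f - μ[f|m]|m] =ᵐ[μ] 0 := by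
  refine (condExp_sub hf integrable_condExp m).trans ?_
  rw [condExp_of_stronglyMeasurable hm stronglyMeasurable_condExp integrable_condExp, sub_self]

variable [IsProbabilityMeasure μ]

theorem isMartingaleDifference_smul_sub_condExp
    (hX : ∀ k, StronglyMeasurable[ℱ (k + 1)] (X k)) (hX₂ : ∀ k, MemLp (X k) 2 μ) :
    IsMartingaleDifference (fun k => γ k • (X k - μ[X k|ℱ k])) ℱ μ where
  stronglyMeasurable k :=
    ((hX k).sub (stronglyMeasurable_condExp.mono (ℱ.mono k.le_succ))).const_smul _
  memLp k := ((hX₂ k).sub ((hX₂ k).condExp one_le_two)).const_smul _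
  condExp_eq_zero k := by
    refine (condExp_smul _ _ _).trans ?_
    filter_upwards [condExp_sub_condExp (ℱ.le k) ((hX₂ k).integrable one_le_two)] with ω hω
    rw [Pi.smul_apply, hω, Pi.zero_apply, smul_zero]

theorem ae_exists_tendsto_sum_sub_condExp (hX : ∀ k, StronglyMeasurable[ℱ (k + 1)] (X k))
    (hB : ∀ k, ∀ᵐ ω ∂μ, |X k ω| ≤ B) (hγ : Summable fun k => γ k ^ 2) :
    ∀ᵐ ω ∂μ, ∃ a, Tendsto (fun n => ∑ k ∈ Finset.range n, γ k * (X k ω - (μ[X k|ℱ k]) ω))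
      atTop (𝓝 a) := by
  have hX₂ : ∀ k, MemLp (X k) 2 μ := fun k =>
    .of_bound ((hX k).mono (ℱ.le _)).aestronglyMeasurable B (hB k)
  refine (isMartingaleDifference_smul_sub_condExp hX hX₂).ae_exists_tendsto_sum
    (Summable.of_nonneg_of_le (fun k => integral_nonneg fun ω => sq_nonneg _) (fun k => ?_)
      (hγ.mul_right ((2 * B) ^ 2)))
  have hcentered : ∀ᵐ ω ∂μ, (X k ω - (μ[X k|ℱ k]) ω) ^ 2 ≤ (2 * B) ^ 2 := by
    filter_upwards [hB k, ae_bdd_abs_condExp_of_ae_bdd_abs (m := ℱ k) (hB k)] with ω hω hωc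
    exact sq_le_sq' (by linarith [(abs_le.1 hω).1, (abs_le.1 hωc).2])
      (by linarith [(abs_le.1 hω).2, (abs_le.1 hωc).1])
  simp only [Pi.smul_apply, Pi.sub_apply, smul_eq_mul, mul_pow, integral_const_mul]
  gcongr
  simpa [mul_pow] using integral_mono_ae ((hX₂ k).sub ((hX₂ k).condExp one_le_two)).integrable_sq
    (integrable_const ((2 * B) ^ 2)) hcentered

end MartingaleDifference

section Freezing

variable {Ω E T : Type*} {m m₀ : MeasurableSpace Ω} {μ : Measure Ω} [IsProbabilityMeasure μ]
  [mE : MeasurableSpace E] [mT : MeasurableSpace T] {H : Ω → E} {Y : Ω → T}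

theorem ae_ae_of_ae_of_indepFun (hH : Measurable H) (hY : Measurable Y) (hind : IndepFun H Y μ)
    {D : Set (E × T)} (hD : MeasurableSet D) (h : ∀ᵐ ω ∂μ, (H ω, Y ω) ∈ D) :
    ∀ᵐ ω ∂μ, ∀ᵐ ω' ∂μ, (H ω, Y ω') ∈ D := by
  have hprod : ∀ᵐ p ∂(μ.map H).prod (μ.map Y), p ∈ D := by
    rw [← (indepFun_iff_map_prod_eq_prod_map_map hH.aemeasurable hY.aemeasurable).1 hind]
    exact (ae_map_iff (hH.prodMk hY).aemeasurable hD).2 h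
  filter_upwards [ae_of_ae_map hH.aemeasurable (Measure.ae_ae_of_ae_prod hprod)] with ω hω
  exact ae_of_ae_map hY.aemeasurable hω

variable [StandardBorelSpace T] [Nonempty T] {f : E × T → ℝ}

theorem condExp_comap_of_indepFun (hH : Measurable H) (hY : Measurable Y)
    (hind : IndepFun H Y μ) (hf : Measurable f) (hint : Integrable (fun ω => f (H ω, Y ω)) μ) :
    μ[fun ω => f (H ω, Y ω)|mE.comap H] =ᵐ[μ] fun ω => ∫ ω', f (H ω, Y ω') ∂μ := by
  have hmap := (indepFun_iff_map_prod_eq_prod_map_map hH.aemeasurable hY.aemeasurable).1 hind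
  have hkernel : condDistrib Y H μ =ᵐ[μ.map H] Kernel.const E (μ.map Y) :=
    condDistrib_ae_eq_of_measure_eq_compProd H hY.aemeasurable
      (by rw [hmap, Measure.compProd_const])
  filter_upwards [condExp_prod_ae_eq_integral_condDistrib hH hY.aemeasurable hf.stronglyMeasurable
    hint, ae_of_ae_map hH.aemeasurable hkernel] with ω hω hωk
  rw [hω, hωk, Kernel.const_apply]
  exact integral_map hY.aemeasurable (hf.comp measurable_prodMk_left).aestronglyMeasurable

theorem condExp_of_indep (hm : m ≤ m₀) (hH : Measurable[m] H)
    (hY : Measurable Y) (hind : Indep m (mT.comap Y) μ) (hf : Measurable f)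
    (hint : Integrable (fun ω => f (H ω, Y ω)) μ) :
    μ[fun ω => f (H ω, Y ω)|m] =ᵐ[μ] fun ω => ∫ ω', f (H ω, Y ω') ∂μ := by
  have hind' : @IndepFun _ _ _ m₀ m mT id Y μ :=
    (@IndepFun_iff_Indep _ _ _ m₀ m mT id Y μ).2 (by rwa [MeasurableSpace.comap_id])
  have hcond := condExp_comap_of_indepFun (mE := m) (f := fun p => f (H p.1, p.2))
    (measurable_id'' hm) hY hind' (hf.comp ((hH.comp measurable_fst).prodMk measurable_snd)) hint
  rwa [MeasurableSpace.comap_id] at hcond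

theorem ae_exists_tendsto_sum_sub_integral {ℱ : Filtration ℕ m₀} {H : ℕ → Ω → E} {Y : ℕ → Ω → T}
    {f : ℕ → E × T → ℝ} {γ : ℕ → ℝ} {B : ℝ} (hH : ∀ k, Measurable[ℱ k] (H k))
    (hY : ∀ k, Measurable[ℱ (k + 1)] (Y k)) (hind : ∀ k, Indep (ℱ k) (mT.comap (Y k)) μ)
    (hf : ∀ k, Measurable (f k)) (hB : ∀ k, ∀ᵐ ω ∂μ, |f k (H k ω, Y k ω)| ≤ B)
    (hγ : Summable fun k => γ k ^ 2) :
    ∀ᵐ ω ∂μ, ∃ a, Tendsto (fun n => ∑ k ∈ Finset.range n,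
      γ k * (f k (H k ω, Y k ω) - ∫ ω', f k (H k ω, Y k ω') ∂μ)) atTop (𝓝 a) := by
  have hX : ∀ k, StronglyMeasurable[ℱ (k + 1)] fun ω => f k (H k ω, Y k ω) := fun k =>
    ((hf k).comp (((hH k).mono (ℱ.mono k.le_succ) le_rfl).prodMk (hY k))).stronglyMeasurable
  have hcond : ∀ k, μ[fun ω => f k (H k ω, Y k ω)|ℱ k] =ᵐ[μ]
      fun ω => ∫ ω', f k (H k ω, Y k ω') ∂μ := fun k =>
    condExp_of_indep (ℱ.le k) (hH k) ((hY k).mono (ℱ.le _) le_rfl) (hind k) (hf k)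
      (.of_bound ((hX k).mono (ℱ.le _)).aestronglyMeasurable B (hB k))
  filter_upwards [ae_exists_tendsto_sum_sub_condExp hX hB hγ, ae_all_iff.2 hcond] with ω hω hωc
  simpa only [hωc] using hω

end Freezing

section PastFiltration

variable {Ω X ι : Type*} {m₀ : MeasurableSpace Ω} {μ : Measure Ω} [mX : MeasurableSpace X]
  {ξ : ℕ → ι → Ω → X}

/-- The σ-algebras generated by the samples of the iterations before `k`. -/
def pastFiltration (hξ : ∀ k j, Measurable (ξ k j)) : Filtration ℕ m₀ where
  seq k := ⨆ p ∈ {p : ℕ × ι | p.1 < k}, mX.comap (ξ p.1 p.2)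
  mono' _ _ hij := biSup_mono fun _ hp => lt_of_lt_of_le hp hij
  le' _ := iSup₂_le fun p _ => (hξ p.1 p.2).comap_le

theorem comap_pi_le_iSup {S : Set (ℕ × ι)} {k : ℕ} (hk : ∀ j, (k, j) ∈ S) :
    MeasurableSpace.pi.comap (fun ω j => ξ k j ω) ≤ ⨆ p ∈ S, mX.comap (ξ p.1 p.2) := by
  rw [← measurable_iff_comap_le]
  exact (@measurable_pi_iff _ _ _ (_) _ _).2 fun j => measurable_iff_comap_le.2
    (le_iSup₂_of_le (f := fun (p : ℕ × ι) (_ : p ∈ S) => mX.comap (ξ p.1 p.2)) (k, j) (hk j) le_rfl)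

theorem measurable_pastFiltration_succ (hξ : ∀ k j, Measurable (ξ k j)) (k : ℕ) :
    Measurable[pastFiltration hξ (k + 1)] fun ω j => ξ k j ω :=
  measurable_iff_comap_le.2
    (comap_pi_le_iSup (S := {p : ℕ × ι | p.1 < k + 1}) fun _ => Nat.lt_succ_self k)

theorem indep_pastFiltration (hξ : ∀ k j, Measurable (ξ k j))
    (hind : iIndepFun (fun p : ℕ × ι => ξ p.1 p.2) μ) (k : ℕ) :
    Indep (pastFiltration hξ k) (MeasurableSpace.pi.comap fun ω j => ξ k j ω) μ :=
  indep_of_indep_of_le_right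
    (indep_iSup_of_disjoint (m := fun p : ℕ × ι => mX.comap (ξ p.1 p.2))
      (S := {p : ℕ × ι | p.1 < k}) (T := {p : ℕ × ι | p.1 = k}) (fun p => (hξ p.1 p.2).comap_le)
      hind.iIndep (disjoint_left.2 fun _ hlt heq => (ne_of_lt hlt) heq))
    (comap_pi_le_iSup (S := {p : ℕ × ι | p.1 = k}) fun _ => rfl)

end PastFiltration

/-! ### Constraint geometry -/

section Orthogonal

variable {E ι : Type*} [NormedAddCommGroup E] [InnerProductSpace ℝ E]

theorem mem_orthogonal_span_iff {t : Set E} {v : E} :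
    v ∈ (Submodule.span ℝ t)ᗮ ↔ ∀ x ∈ t, inner ℝ v x = 0 := by
  rw [← Submodule.span_singleton_le_iff_mem, ← Submodule.isOrtho_iff_le, Submodule.isOrtho_span]
  simp

theorem starProjection_orthogonal_span_image [FiniteDimensional ℝ E] {u : ι → E}
    (hu : Orthonormal ℝ u) (t : Finset ι) (v : E) :
    (Submodule.span ℝ (u '' t))ᗮ.starProjection v = v - ∑ i ∈ t, inner ℝ (u i) v • u i := by
  refine Submodule.eq_starProjection_of_mem_of_inner_eq_zero ?_ fun w hw => ?_
  · rw [mem_orthogonal_span_iff]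
    rintro _ ⟨j, hj, rfl⟩
    rw [inner_sub_left, hu.inner_left_sum _ hj, real_inner_comm]
    simp
  · rw [mem_orthogonal_span_iff, forall_mem_image] at hw
    rw [sub_sub_cancel, sum_inner]
    exact Finset.sum_eq_zero fun i hi => by
      rw [inner_smul_left, real_inner_comm w (u i), hw hi, mul_zero]

end Orthogonal

section Constraints

variable {n l s : ℕ} {A : Matrix (Fin l) (Fin n) ℝ} {q : Fin s → Vec n → ℝ}

/-- The directions along which `h ↦ A h` is constant; `L` is the orthogonal projection onto it. -/
def feasibleDirections (A : Matrix (Fin l) (Fin n) ℝ) : Submodule ℝ (Vec n) :=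
  (Submodule.span ℝ (range (rowVec A)))ᗮ

theorem mem_feasibleDirections {v : Vec n} : v ∈ feasibleDirections A ↔ A *ᵥ v.ofLp = 0 := by
  simp [feasibleDirections, mem_orthogonal_span_iff, funext_iff, rowVec, PiLp.inner_apply,
    Matrix.mulVec, dotProduct]

theorem subspaceProj_eq_starProjection {u : OrthonormalBasis (Fin n) ℝ (Vec n)} {M : ℕ}
    (hu : SpansRows A u M) : subspaceProj u M = (feasibleDirections A).starProjection := by
  ext1 v
  have hspan := starProjection_orthogonal_span_image u.orthonormal
    (Finset.univ.filter fun i : Fin n => i.val < M) v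
  simp only [Finset.coe_filter, Finset.mem_univ, true_and, hu.2] at hspan
  exact hspan.symm

theorem starProjection_feasibleDirections_transpose_mulVec (v : Fin l → ℝ) :
    (feasibleDirections A).starProjection (WithLp.toLp 2 (Aᵀ *ᵥ v)) = 0 := by
  have hrows : WithLp.toLp 2 (Aᵀ *ᵥ v) = ∑ j, v j • rowVec A j := by
    ext i
    simp [rowVec, Matrix.mulVec, dotProduct, mul_comm]
  rw [feasibleDirections, Submodule.starProjection_apply_eq_zero_iff,
    Submodule.orthogonal_orthogonal, hrows]
  exact Submodule.sum_mem _ fun j _ => Submodule.smul_mem _ _ (Submodule.subset_span ⟨j, rfl⟩)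

/-- The inequality constraints `q^1, …, q^s` as a single map into `ℝˢ`. -/
def constraintMap (q : Fin s → Vec n → ℝ) (h : Vec n) : Vec s :=
  WithLp.toLp 2 fun i => q i h

/-- `v ↦ Dq(h)ᵀ v` as a continuous linear map. -/
def jacobianTranspose (q : Fin s → Vec n → ℝ) (h : Vec n) : Vec s →L[ℝ] Vec n :=
  ∑ i, (EuclideanSpace.proj i).smulRight (gradient (q i) h)

theorem jacobianTranspose_apply (h : Vec n) (v : Vec s) :
    jacobianTranspose q h v = jacobianTransposeMul q h v := by
  simp [jacobianTranspose, jacobianTransposeMul]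

theorem sub_eq_inner_gradient_of_affine {f : Vec n → ℝ} (hf : ∃ g : Vec n →ᵃ[ℝ] ℝ, f = g)
    (z x y : Vec n) : f x - f y = inner ℝ (gradient f z) (x - y) := by
  obtain ⟨g, rfl⟩ := hf
  have hderiv : HasFDerivAt g (LinearMap.toContinuousLinearMap g.linear) z :=
    ContinuousAffineMap.hasFDerivAt (f := ⟨g, g.continuous_of_finiteDimensional⟩)
  rw [inner_gradient_left, hderiv.fderiv]
  exact (g.linearMap_vsub x y).symm

section Affine

variable (hq : ∀ i, ∃ f : Vec n →ᵃ[ℝ] ℝ, q i = f)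
include hq

theorem continuous_constraintMap : Continuous (constraintMap q) := by
  refine (PiLp.continuous_toLp 2 _).comp (continuous_pi fun i => ?_)
  obtain ⟨f, hf⟩ := hq i
  rw [hf]
  exact f.continuous_of_finiteDimensional

theorem inner_constraintMap_sub (z x y : Vec n) (v : Vec s) :
    inner ℝ (constraintMap q x - constraintMap q y) v =
      inner ℝ (x - y) (jacobianTranspose q z v) := by
  rw [jacobianTranspose_apply, jacobianTransposeMul, inner_sum, PiLp.inner_apply]
  refine Finset.sum_congr rfl fun i _ => ?_
  rw [real_inner_smul_right, real_inner_comm _ (x - y), ← sub_eq_inner_gradient_of_affine (hq i)]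
  rfl

theorem jacobianTranspose_eq (x y : Vec n) : jacobianTranspose q x = jacobianTranspose q y :=
  ContinuousLinearMap.ext fun v => ext_inner_left ℝ fun w => by
    rw [← sub_zero w, ← inner_constraintMap_sub hq, ← inner_constraintMap_sub hq]

end Affine

theorem IsKKTPoint.isProjectedKKT {F : Vec n → Vec n} {b : Fin l → ℝ} {h : Vec n} {lam : Vec s}
    {mu : Vec l} (hkkt : IsKKTPoint F A b q h lam mu) :
    IsProjectedKKT (feasibleDirections A) F (jacobianTranspose q h) (constraintMap q) (h, lam)
    where
  stationary := by
    have hproj := congrArg (feasibleDirections A).starProjection hkkt.stationary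
    rwa [map_add, starProjection_feasibleDirections_transpose_mulVec, add_zero, map_zero,
      ← jacobianTranspose_apply] at hproj
  ineq_constraint := hkkt.ineq_constraint
  multiplier_nonneg := hkkt.multiplier_nonneg
  complementarity i :=
    (Finset.sum_eq_zero_iff_of_nonpos fun i _ => mul_nonpos_of_nonneg_of_nonpos
      (hkkt.multiplier_nonneg i) (hkkt.ineq_constraint i)).1 hkkt.complementarity i
      (Finset.mem_univ i)

theorem LICQ.eq_zero_of_starProjection_eq_zero {h : Vec n} (hlicq : LICQ A q h) {v : Vec s}
    (hv : ∀ i, q i h ≠ 0 → v i = 0)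
    (hproj : (feasibleDirections A).starProjection (jacobianTranspose q h v) = 0) : v = 0 := by
  obtain ⟨hactive, -, hdisjoint⟩ := linearIndependent_sum.1 hlicq
  rw [Sum.elim_comp_inl] at hactive
  rw [Sum.elim_comp_inl, Sum.elim_comp_inr] at hdisjoint
  have hsum : jacobianTranspose q h v =
      ∑ i : {i : Fin s // q i h = 0}, v i • gradient (q i) h := by
    classical
    rw [jacobianTranspose_apply, jacobianTransposeMul, ← Finset.sum_subtype
      (Finset.univ.filter fun i => q i h = 0) (by simp) (fun i => v i • gradient (q i) h)]
    refine (Finset.sum_filter_of_ne fun i _ hi => ?_).symm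
    by_contra hqi
    exact hi (by rw [hv i hqi, zero_smul])
  have hrows : jacobianTranspose q h v ∈ Submodule.span ℝ (range (rowVec A)) := by
    rwa [feasibleDirections, Submodule.starProjection_apply_eq_zero_iff,
      Submodule.orthogonal_orthogonal] at hproj
  have hzero : jacobianTranspose q h v = 0 :=
    Submodule.disjoint_def.1 hdisjoint _ (hsum ▸ Submodule.sum_mem _ fun i _ =>
      Submodule.smul_mem _ _ (Submodule.subset_span ⟨i, rfl⟩)) hrows
  have hcoeff := Fintype.linearIndependent_iff.1 hactive (fun i => v i) (hsum ▸ hzero)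
  ext i
  by_cases hi : q i h = 0
  exacts [hcoeff ⟨i, hi⟩, hv i hi]

end Constraints

/-! ### The stochastic algorithm -/

section Algorithm

variable {n m l s : ℕ} {C : Vec n → Vec m → Vec n} {P : Measure (Vec m)} {α B : ℝ}
  {A : Matrix (Fin l) (Fin n) ℝ} {q : Fin s → Vec n → ℝ}
  {u : OrthonormalBasis (Fin n) ℝ (Vec n)} {M : ℕ} {γ : ℕ → ℝ} {N : ℕ → ℕ} {h₀ : Vec n}
  {lam₀ : Vec s}

theorem iter_succ_eq_primalDualStep (hq : ∀ i, ∃ f : Vec n →ᵃ[ℝ] ℝ, q i = f)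
    (hu : SpansRows A u M) (z : Vec n)
    {x : ℕ → ℕ → Vec m} {k : ℕ} {y : Vec n × Vec s}
    (hy : y = iter α P C q (subspaceProj u M) γ N h₀ lam₀ x k) :
    iter α P C q (subspaceProj u M) γ N h₀ lam₀ x (k + 1) =
      primalDualStep (feasibleDirections A) (cvarMap α P C) (jacobianTranspose q z)
        (constraintMap q) (γ k) (estError α P C (N k) (x k) y.1) y := by
  subst hy
  rw [iter, primalDualStep, subspaceProj_eq_starProjection hu, ← jacobianTranspose_apply,
    jacobianTranspose_eq hq z]
  rfl

theorem isBoundedRun_of_eq_iter (hq : ∀ i, ∃ f : Vec n →ᵃ[ℝ] ℝ, q i = f) (hu : SpansRows A u M)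
    {z : Vec n × Vec s} (hz : A *ᵥ h₀.ofLp = A *ᵥ z.1.ofLp) (hlam₀ : ∀ i, 0 ≤ lam₀ i)
    {x : ℕ → ℕ → Vec m} {y : ℕ → Vec n × Vec s}
    (hy : ∀ k, y k = iter α P C q (subspaceProj u M) γ N h₀ lam₀ x k)
    (hB : ∀ k, ‖(y k).1‖ ≤ B ∧ ‖(y k).2‖ ≤ B ∧ ‖estError α P C (N k) (x k) (y k).1‖ ≤ B) :
    IsBoundedRun (feasibleDirections A) (cvarMap α P C) (jacobianTranspose q z.1)
      (constraintMap q) z B γ (fun k => estError α P C (N k) (x k) (y k).1) y where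
  step k := by rw [hy (k + 1), iter_succ_eq_primalDualStep hq hu z.1 (hy k)]
  start_mem := by
    rw [hy 0, iter, mem_feasibleDirections, WithLp.ofLp_sub, Matrix.mulVec_sub, hz, sub_self]
  start_nonneg i := by simpa only [hy 0, iter] using hlam₀ i
  norm_fst_le k := (hB k).1
  norm_snd_le k := (hB k).2.1
  norm_error_le k := (hB k).2.2

theorem measurable_estError {N : ℕ} [NeZero N] (hC : Measurable (Function.uncurry C))
    (hα₀ : 0 < α) (hα₁ : α ≤ 1) (hcont : Continuous (cvarMap α P C)) :
    Measurable fun p : Vec n × (ℕ → Vec m) => estError α P C N p.2 p.1 := by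
  refine Measurable.sub ?_ (hcont.measurable.comp measurable_fst)
  refine (WithLp.measurable_toLp 2 _).comp (measurable_pi_iff.2 fun i => ?_)
  refine (measurable_empCVaR hα₀ hα₁).comp (measurable_pi_iff.2 fun j => ?_)
  exact (measurable_pi_apply i).comp ((WithLp.measurable_ofLp 2 _).comp (hC.comp
    (measurable_fst.prodMk ((measurable_pi_apply j).comp measurable_snd))))

variable {Ω : Type*} [MeasurableSpace Ω] {ξ : ℕ → ℕ → Ω → Vec m}

theorem measurable_iter [∀ k, NeZero (N k)] (hC : Measurable (Function.uncurry C)) (hα₀ : 0 < α)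
    (hα₁ : α ≤ 1) (hcont : Continuous (cvarMap α P C))
    (hq : ∀ i, ∃ f : Vec n →ᵃ[ℝ] ℝ, q i = f) (hu : SpansRows A u M)
    (hξ : ∀ k j, Measurable (ξ k j)) (k : ℕ) :
    Measurable[pastFiltration hξ k] fun ω =>
      iter α P C q (subspaceProj u M) γ N h₀ lam₀ (fun k j => ξ k j ω) k := by
  induction k with
  | zero => exact measurable_const
  | succ k ih =>
    have hcurrent := ih.mono ((pastFiltration hξ).mono k.le_succ) le_rfl
    have herror := (measurable_estError (N := N k) hC hα₀ hα₁ hcont).comp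
      (hcurrent.fst.prodMk (measurable_pastFiltration_succ hξ k))
    have hstep := (continuous_primalDualStep (U := feasibleDirections A)
      (G := jacobianTranspose q 0) (γ := γ k) hcont (continuous_constraintMap hq)).measurable
    simp only [iter_succ_eq_primalDualStep hq hu 0 rfl]
    exact hstep.comp (herror.prodMk hcurrent)

variable {μ : Measure Ω} [IsProbabilityMeasure μ]

theorem ae_integral_norm_estError_le [IsProbabilityMeasure P] {N : ℕ} [NeZero N]
    {ξ : ℕ → Ω → Vec m} {h : Ω → Vec n} (hξ : IsIIDSample ξ P μ)
    (hC : Measurable (Function.uncurry C)) (hα₀ : 0 < α) (hα₁ : α ≤ 1)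
    (hcont : Continuous (cvarMap α P C)) (hh : Measurable h)
    (hind : IndepFun h (fun ω j => ξ j ω) μ)
    (hB : ∀ᵐ ω ∂μ, ‖estError α P C N (fun j => ξ j ω) (h ω)‖ ≤ B) :
    ∀ᵐ ω ∂μ, ∫ ω', ‖estError α P C N (fun j => ξ j ω') (h ω)‖ ∂μ ≤ n * (α⁻¹ * (B / √N)) :=
  (ae_ae_of_ae_of_indepFun hh (measurable_pi_iff.2 hξ.measurable) hind
    (measurableSet_le (measurable_estError hC hα₀ hα₁ hcont).norm measurable_const) hB).mono
    fun _ hω => hξ.integral_norm_estError_le hC hα₀ hα₁ hω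

theorem ae_exists_compensator [IsProbabilityMeasure P] [∀ k, NeZero (N k)]
    (hξ : IsIIDSample (fun p : ℕ × ℕ => ξ p.1 p.2) P μ) (hC : Measurable (Function.uncurry C))
    (hα₀ : 0 < α) (hα₁ : α ≤ 1) (hcont : Continuous (cvarMap α P C)) {h : ℕ → Ω → Vec n}
    (hh : ∀ k, Measurable[pastFiltration (fun k j => hξ.measurable (k, j)) k] (h k))
    (hB : ∀ k, ∀ᵐ ω ∂μ, ‖estError α P C (N k) (fun j => ξ k j ω) (h k ω)‖ ≤ B)
    (hγ : Summable fun k => γ k ^ 2) :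
    ∀ᵐ ω ∂μ, ∃ (e : ℕ → ℝ) (a : ℝ), (∀ k, e k ≤ n * (α⁻¹ * (B / √(N k)))) ∧
      Tendsto (fun K => ∑ k ∈ Finset.range K,
        γ k * (‖estError α P C (N k) (fun j => ξ k j ω) (h k ω)‖ - e k)) atTop (𝓝 a) := by
  set hmeas : ∀ k j, Measurable (ξ k j) := fun k j => hξ.measurable (k, j)
  have hfresh := indep_pastFiltration hmeas hξ.iIndepFun
  have hmean (k : ℕ) := ae_integral_norm_estError_le
    (hξ.precomp (g := fun j => (k, j)) (Prod.mk_right_injective k)) hC hα₀ hα₁ hcont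
    ((hh k).mono ((pastFiltration hmeas).le k) le_rfl)
    ((IndepFun_iff_Indep ..).2 (indep_of_indep_of_le_left (hfresh k) (hh k).comap_le)) (hB k)
  have hnoise := ae_exists_tendsto_sum_sub_integral hh (measurable_pastFiltration_succ hmeas)
    hfresh (f := fun k p => ‖estError α P C (N k) p.2 p.1‖)
    (fun k => (measurable_estError (N := N k) hC hα₀ hα₁ hcont).norm)
    (fun k => (hB k).mono fun ω hω => (abs_norm _).trans_le hω) hγ
  filter_upwards [ae_all_iff.2 hmean, hnoise] with ω hω ⟨a, ha⟩
  exact ⟨_, a, hω, ha⟩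

end Algorithm

theorem exists_forall_ge_mul_div_sqrt_le (a c B : ℝ) {τ : ℝ} (hτ : 0 < τ) :
    ∃ N₀ : ℕ, ∀ N ≥ N₀, N ≠ 0 ∧ a * (c * (B / √N)) ≤ τ := by
  have hsqrt : Tendsto (fun N : ℕ => √(N : ℝ)) atTop atTop :=
    Real.tendsto_sqrt_atTop.comp tendsto_natCast_atTop_atTop
  have hlim : Tendsto (fun N : ℕ => a * (c * (B / √N))) atTop (𝓝 0) := by
    simpa using ((hsqrt.const_div_atTop B).const_mul c).const_mul a
  exact eventually_atTop.1 ((eventually_ne_atTop 0).and (hlim.eventually_le_const hτ))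

theorem proposition3_general {n m l s : ℕ}
    {C : Vec n → Vec m → Vec n} (hC : Measurable (Function.uncurry C))
    {P : Measure (Vec m)} [IsProbabilityMeasure P]
    {α : ℝ} (hα₀ : 0 < α) (hα₁ : α ≤ 1)
    (_hfin : ∀ h i, HasFiniteCVaR α P fun x => C h x i) (hcont : Continuous (cvarMap α P C))
    {A : Matrix (Fin l) (Fin n) ℝ} {b : Fin l → ℝ} {q : Fin s → Vec n → ℝ}
    (hq : ∀ i, ∃ f : Vec n →ᵃ[ℝ] ℝ, q i = f)
    {hstar : Vec n} (hmono : ∀ h, h ≠ hstar →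
      0 < inner ℝ (cvarMap α P C h - cvarMap α P C hstar) (h - hstar))
    (hlicq : LICQ A q hstar) {lamstar : Vec s} {mustar : Vec l}
    (hkkt : IsKKTPoint (cvarMap α P C) A b q hstar lamstar mustar)
    {u : OrthonormalBasis (Fin n) ℝ (Vec n)} {M : ℕ} (hu : SpansRows A u M) :
    ∀ ε : ℝ, 0 < ε → ∀ B : ℝ, ∃ Nε : ℕ,
      ∀ {Ω : Type*} [MeasurableSpace Ω] (μ : Measure Ω) [IsProbabilityMeasure μ]
        (ξ : ℕ → ℕ → Ω → Vec m)
        (_ : ∀ k j, Measurable (ξ k j)) (_ : ∀ k j, μ.map (ξ k j) = P)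
        (_ : iIndepFun (fun p : ℕ × ℕ => ξ p.1 p.2) μ)
        (γ : ℕ → ℝ) (_ : ∀ k, 0 < γ k)
        (_ : Tendsto (fun K => ∑ k ∈ Finset.range K, γ k) atTop atTop)
        (_ : Summable fun k => γ k ^ 2)
        (N : ℕ → ℕ) (h₀ : Vec n) (_ : A *ᵥ h₀.ofLp = b)
        (lam₀ : Vec s) (_ : ∀ i, 0 ≤ lam₀ i)
        (h : ℕ → Ω → Vec n) (lam : ℕ → Ω → Vec s)
        (_ : ∀ k ω, (h k ω, lam k ω) =
          iter α P C q (subspaceProj u M) γ N h₀ lam₀ (fun k j => ξ k j ω) k)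
        (_ : ∀ᵐ ω ∂μ, ∀ k, ‖h k ω‖ ≤ B ∧ ‖lam k ω‖ ≤ B ∧
          ‖estError α P C (N k) (fun j => ξ k j ω) (h k ω)‖ ≤ B),
        (∀ k, Nε ≤ N k) →
          ∀ᵐ ω ∂μ, limsup (fun k => ‖h k ω - hstar‖) atTop ≤ ε := by
  intro ε hε B
  obtain ⟨τ, hτ, htol⟩ := exists_error_tolerance hcont (continuous_constraintMap hq)
    hkkt.isProjectedKKT (inner_constraintMap_sub hq hstar) hmono
    (fun _ => hlicq.eq_zero_of_starProjection_eq_zero) hε B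
  obtain ⟨Nε, hNε⟩ := exists_forall_ge_mul_div_sqrt_le n α⁻¹ B hτ
  refine ⟨Nε, fun μ _ ξ hξ hP hindep γ hγ₀ hγ hγ₂ N h₀ hh₀ lam₀ hlam₀ h lam hiter hbound hN => ?_⟩
  have : ∀ k, NeZero (N k) := fun k => ⟨(hNε _ (hN k)).1⟩
  have hpast : ∀ k, Measurable[pastFiltration hξ k] (h k) := fun k => by
    have hfst := (measurable_iter (N := N) (h₀ := h₀) (lam₀ := lam₀) (γ := γ) hC hα₀ hα₁ hcont hq
      hu hξ k).fst
    simpa only [← hiter] using hfst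
  have hcompensator := ae_exists_compensator ⟨fun p => hξ p.1 p.2, fun p => hP p.1 p.2, hindep⟩
    hC hα₀ hα₁ hcont hpast (fun k => hbound.mono fun ω hω => (hω k).2.2) hγ₂
  filter_upwards [hbound, hcompensator] with ω hω ⟨e, a, he, ha⟩
  have hrun := isBoundedRun_of_eq_iter (z := (hstar, lamstar)) (y := fun k => (h k ω, lam k ω))
    hq hu (hh₀.trans hkkt.eq_constraint.symm) hlam₀ (fun k => hiter k ω) hω
  have hclose := htol γ _ _ e a ⟨hγ₀, hγ, hγ₂⟩ hrun
    (fun k => (he k).trans (hNε _ (hN k)).2) ha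
  exact limsup_le_of_le (isCoboundedUnder_le_of_le atTop fun k => norm_nonneg _) hclose

end CVaRVI

end

open CVaRVI in
theorem proposition3 {n m l s : ℕ}
    -- the uncertain costs, the distribution of the uncertainty and the risk level
    (C : Vec n → Vec m → Vec n) (hC : Measurable (Function.uncurry C))
    (P : Measure (Vec m)) [IsProbabilityMeasure P]
    (α : ℝ) (hα₀ : 0 < α) (hα₁ : α ≤ 1)
    (hfin : ∀ h i, HasFiniteCVaR α P fun x => C h x i)
    (hmono : IsStrictlyMonotone (cvarMap α P C)) (hcont : Continuous (cvarMap α P C))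
    -- the constraints
    (A : Matrix (Fin l) (Fin n) ℝ) (b : Fin l → ℝ) (q : Fin s → Vec n → ℝ)
    (hq : ∀ i, ∃ f : Vec n →ᵃ[ℝ] ℝ, q i = f)
    (hcomp : IsCompact (feasibleSet A b q))
    -- the solution and its multipliers
    (hstar : Vec n) (hsol : hstar ∈ SOL (feasibleSet A b q) (cvarMap α P C))
    (hlicq : LICQ A q hstar)
    (lamstar : Vec s) (mustar : Vec l)
    (hkkt : IsKKTPoint (cvarMap α P C) A b q hstar lamstar mustar)
    -- the matrix `L`
    (u : OrthonormalBasis (Fin n) ℝ (Vec n)) (M : ℕ) (hu : SpansRows A u M) :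
    ∀ ε : ℝ, 0 < ε → ∀ B : ℝ, ∃ Nε : ℕ,
      ∀ {Ω : Type*} [MeasurableSpace Ω] (μ : Measure Ω) [IsProbabilityMeasure μ]
        -- `ξ k j` is the `j`-th sample in iteration `k`
        (ξ : ℕ → ℕ → Ω → Vec m)
        (_ : ∀ k j, Measurable (ξ k j)) (_ : ∀ k j, μ.map (ξ k j) = P)
        (_ : iIndepFun (fun p : ℕ × ℕ => ξ p.1 p.2) μ)
        (γ : ℕ → ℝ) (_ : ∀ k, 0 < γ k)
        (_ : Tendsto (fun K => ∑ k ∈ Finset.range K, γ k) atTop atTop)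
        (_ : Summable fun k => γ k ^ 2)
        (N : ℕ → ℕ) (h₀ : Vec n) (_ : A *ᵥ h₀.ofLp = b)
        (lam₀ : Vec s) (_ : ∀ i, 0 ≤ lam₀ i)
        (h : ℕ → Ω → Vec n) (lam : ℕ → Ω → Vec s)
        (_ : ∀ k ω, (h k ω, lam k ω) =
          iter α P C q (subspaceProj u M) γ N h₀ lam₀ (fun k j => ξ k j ω) k)
        (_ : ∀ᵐ ω ∂μ, ∀ k, ‖h k ω‖ ≤ B ∧ ‖lam k ω‖ ≤ B ∧
          ‖estError α P C (N k) (fun j => ξ k j ω) (h k ω)‖ ≤ B),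
        (∀ k, Nε ≤ N k) →
          ∀ᵐ ω ∂μ, limsup (fun k => ‖h k ω - hstar‖) atTop ≤ ε :=
  proposition3_general hC hα₀ hα₁ hfin hcont hq (fun h hne => hmono h hstar hne) hlicq hkkt hu
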